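/- **Setting.** Let $\mathcal A$ be a finite ordered set and $p(g\mid a_{-\infty}^{-1})$, $g\in\mathcal A$, a probability distribution on $\mathcal A$ for each past $a_{-\infty}^{-1}\in\mathcal A^{\mathbb N}$. Strings are read from the present to the past, $a_m^n=(a_n,a_{n-1},\dots,a_m)$, and $p(a_{-n}^{-1}\mid a_{-\infty}^{-(n+1)})=\prod_{i=1}^n p(a_{-i}\mid a_{-\infty}^{-i-1})$. Let $$\mathcal H=\Big\{a_{-\infty}^{-1}: \sup_{b_{-\infty}^{-(n+1)}\in\mathcal A^{\mathbb N}}p(a_{-n}^{-1}\mid b_{-\infty}^{-(n+1)})>0\ \ \forall n\ge1\Big\}$$ be the set of admissible histories, and suppose that it is add invariant: if $a_{-\infty}^{-1}\in\mathcal H$ and $p(g\mid a_{-\infty}^{-1})>0$, then $ga_{-\infty}^{-1}\in\mathcal H$. Let $*$ be an additional symbol ("unknown"), $\mathcal A_*=\mathcal A\cup\{*\}$. For $n\ge 0$, $b_{-n}^{-1}\in\mathcal A_*^n$ and $g\in\mathcal A$ put $$\alpha(g\mid b_{-n}^{-1})=\inf\{p(g\mid a_{-\infty}^{-1}):a_{-\infty}^{-1}\in\mathcal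 H,\ a_{-j}=b_{-j}\text{ for all }j\le n\text{ with }b_{-j}\in\mathcal A\},\qquad \beta(b_{-n}^{-1})=\sum_{g\in\mathcal A}\alpha(g\mid b_{-n}^{-1}),$$ where $\inf\emptyset=0$, and let $\beta$ be the value of $\beta(\cdot)$ at the empty string. For $n\ge1$ let $\mathcal C_n=\{a_{-n}^{-1}:a_{-\infty}^{-1}\in\mathcal H\}$ and $\beta_n=\inf_{x\in\mathcal C_n}\beta(x)$; if $\beta_n>0$, let $p^{[n]}_{Markov}(g\mid x)=\alpha(g\mid x)/\beta(x)$, the transition probabilities of a Markov chain of order $n$, viewed as a Markov chain on $\mathcal C_n$. Let $\hat n$ be the least $n\ge1$ such that $\beta_n>0$ and exactly one communicating class of $p^{[n]}_{Markov}$ is closed, and this class is aperiodic ($\hat n=\infty$ if there is none). **Assumption 1.** $\mathcal A$ is finite, $\beta=0$ and $\hat n<\infty$. Let $\mathcal C=\mathcal C_{\hat n}$ and let $\mathcal U\subset\mathcal C$ be the closed class of $p^{[\hat n]}_{Markov}$. For $n\ge1$ let $$\tilde\rho_n=\sum_{x\in\mathcal U}\ \sum_{a_{-n}^{-1}\in\mathcal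 A^n}\alpha(a_{-n}\mid x)\,\alpha(a_{-(n-1)}\mid a_{-n}x)\cdots\alpha(a_{-1}\mid a_{-n}^{-2}x).$$ **Algorithm 2.** Let $(U_m^a: m\in\mathbb Z,\ a\in\mathcal C)$ be i.i.d. uniform random variables on $[0,1)$; below, the infimum of an empty subset of $\mathcal A$ is $*$. For $a\in\mathcal C$ and $n\ge0$ let $Y_n^a=\inf\{g:U_n^a<\sum_{b\le g}\alpha(b\mid (Y^a)_0^{n-1}a)\}$, and let $n_0$ be the least $m\ge\hat n$ such that $\mathbb P\big((Y^a)_{m-\hat n}^{m-1}=b\text{ for all }a\in\mathcal C\big)>0$ for every $b\in\mathcal U$. For $z\in\mathbb Z$ let $l_z=(z-1)n_0+1$ and $I_z=\{l_z,\dots,zn_0\}$. For $m\in I_z$ and $a\in\mathcal C$ let $X^a_m=\inf\{g:U_m^a<\sum_{b\le g}\alpha(b\mid (X^a)_{l_z}^{m-1}a)\}$. The temporary values $X_m^{(j)}\in\mathcal A_*$ ($m\in I_z$, $j\le z$) are defined as follows. * $X_m^{(z)}=g$ if $X_m^a=g$ for all $a\in\mathcal C$, for some $g\in\mathcal A$;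 otherwise $X_m^{(z)}=*$. * For $j<z$: $X_m^{(j)}=X_m^{(j+1)}$ if $X_m^{(j+1)}\ne *$ or if $(X^{(j)})_{l_z-\hat n}^{l_z-1}$ contains a $*$ or is not in $\mathcal C$. * For $j<z$, $X_m^{(j+1)}=*$ and $(X^{(j)})_{l_z-\hat n}^{l_z-1}=b\in\mathcal C$: if $j+1<z$ and $(X^{(j+1)})_{l_z-\hat n}^{l_z-1}=b$ already, let $w=(X^{(j+1)})_{l_{j+1}}^{m-1}$; otherwise put $X_m^{(j)}=X_m^b$ in case $X_m^b\neq *$, and let $w=(X^b)_{l_z}^{m-1}b$ in case $X_m^b=*$. Where $w$ has been defined, $$X_m^{(j)}=\inf\Big\{g:U_m^b<\beta(w)+\sum_{c\le g}\big(\alpha(c\mid (X^{(j)})_{l_j}^{m-1})-\alpha(c\mid w)\big)\Big\}.$$ For $k\ge 0$, the algorithm with input $k$ computes in its rounds $r=0,1,2,\dots$ the values $X_m^{(-r)}$ for $m\in I_{-r}\cup\dots\cup I_0$ (all values at times that have not been reached being $*$), and stops as soon as $X_{-i}^{(-r)}\ne *$ for all $i=0,\dots,k$. For $n\in I_z$ let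 $\tilde T[n]=\sup\{j\le z: X_n^{(j)}\ne *\}$ ($-\infty$ if there is no such $j$), and for $m<n$ let $\tilde T[m,n]=\inf\{\tilde T[k]:k=m,\dots,n\}$. **Theorem 6.** Suppose that Assumption 1 holds and that $\sum_{n=1}^\infty\tilde\rho_n=\infty$. Then for any $n\ge1$, $\mathbb P(|\tilde T[0,n]|<+\infty)=1$. Moreover, for every $k\ge0$, Algorithm 2 with input $k$ stops after finitely many rounds almost surely. -/

import Mathlib

open MeasureTheory ProbabilityTheory

noncomputable section

namespace PerfectSim

/-- A probability kernel on the finite alphabet `A`: `p.prob g a` is `p(g | a)`.  A past is a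
sequence `a : ℕ → A` read from the present to the past, `a i` being the symbol `a_{-(i+1)}`. -/
structure ProbKernel (A : Type*) [Fintype A] where
  prob : A → (ℕ → A) → ℝ
  prob_nonneg : ∀ g a, 0 ≤ prob g a
  sum_prob : ∀ a, ∑ g, prob g a = 1

/-- The past `g a`, in which `g` is the most recent symbol. -/
def consPast {A : Type*} (g : A) (a : ℕ → A) : ℕ → A
  | 0 => g
  | i + 1 => a i

/-- Concatenation of a finite string (most recent symbol first) and a past. -/
def appendPast {A : Type*} : List A → (ℕ → A) → (ℕ → A)
  | [], a => a
  | g :: w, a => consPast g (appendPast w a)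

/-- The first `n` symbols `a_{-n}^{-1}` of a past, the most recent one at index `0`. -/
def pastPrefix {A : Type*} (n : ℕ) (a : ℕ → A) : Fin n → A := fun i => a i

variable {A : Type*} [Fintype A]

/-- The probability `p(w | a)` of the finite string `w` (most recent symbol first) after the
past `a`. -/
def stringProb (p : ProbKernel A) : List A → (ℕ → A) → ℝ
  | [], _ => 1
  | g :: w, a => p.prob g (appendPast w a) * stringProb p w a

/-- The set `H` of admissible histories. -/
def admissible (p : ProbKernel A) : Set (ℕ → A) :=
  {a | ∀ n : ℕ, 1 ≤ n → 0 < ⨆ c : ℕ → A, stringProb p (List.ofFn (pastPrefix n a)) c}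

/-- Add invariance of `H`: a history extended by a symbol of positive probability is
admissible. -/
def AddInvariant (p : ProbKernel A) : Prop :=
  ∀ a ∈ admissible p, ∀ g : A, 0 < p.prob g a → consPast g a ∈ admissible p

/-- The past `a` has the symbols prescribed by the string `w` over `A ∪ {*}` (most recent symbol
first).  Throughout, `A ∪ {*}` is `WithTop A` and the unknown symbol `*` is `⊤`. -/
def Agrees (w : List (WithTop A)) (a : ℕ → A) : Prop :=
  ∀ (j : ℕ) (g : A), w[j]? = some (g : WithTop A) → a j = g

/-- `α(g | w)`; the infimum over the empty set is `0`. -/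
def alpha (p : ProbKernel A) (g : A) (w : List (WithTop A)) : ℝ :=
  sInf ((fun a => p.prob g a) '' {a | a ∈ admissible p ∧ Agrees w a})

/-- `β(w)`; for the empty string this is `β`. -/
def beta (p : ProbKernel A) (w : List (WithTop A)) : ℝ := ∑ g, alpha p g w

/-- A finite string over `A`, as a list over `A ∪ {*}`, most recent symbol first. -/
def toStarList {n : ℕ} (x : Fin n → A) : List (WithTop A) :=
  List.ofFn fun i => (x i : WithTop A)

/-! ### The Markov approximations -/

/-- The strings of length `n` that are beginnings of admissible histories. -/
def admStrings (p : ProbKernel A) (n : ℕ) : Set (Fin n → A) :=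
  pastPrefix n '' admissible p

/-- `β_n`. -/
def betaN (p : ProbKernel A) (n : ℕ) : ℝ :=
  sInf ((fun x => beta p (toStarList x)) '' admStrings p n)

/-- The transition probability `p_Markov^{[n]}(g | x)`. -/
def pMarkov (p : ProbKernel A) (n : ℕ) (g : A) (x : Fin n → A) : ℝ :=
  alpha p g (toStarList x) / beta p (toStarList x)

/-- The string of length `n` obtained from `x` by adding the new most recent symbol `g` and
dropping the oldest one. -/
def shiftIn {n : ℕ} (g : A) (x : Fin n → A) : Fin n → A :=
  fun i => (Fin.cons g x : Fin (n + 1) → A) i.castSucc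

/-- `x → y` is a transition of positive probability of the Markov chain on the strings of
length `n`. -/
def MarkovEdge (p : ProbKernel A) (n : ℕ) (x y : Fin n → A) : Prop :=
  x ∈ admStrings p n ∧ y ∈ admStrings p n ∧ ∃ g, shiftIn g x = y ∧ 0 < pMarkov p n g x

/-- `y` is reached from `x` in exactly `k` steps with positive probability. -/
def ReachIn (p : ProbKernel A) (n : ℕ) : ℕ → (Fin n → A) → (Fin n → A) → Prop
  | 0, x, y => x = y
  | k + 1, x, y => ∃ z, MarkovEdge p n x z ∧ ReachIn p n k z y

/-- `x` and `y` communicate. -/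
def Communicate (p : ProbKernel A) (n : ℕ) (x y : Fin n → A) : Prop :=
  (∃ k, ReachIn p n k x y) ∧ ∃ k, ReachIn p n k y x

/-- `K` is a closed communicating class. -/
def IsClosedClass (p : ProbKernel A) (n : ℕ) (K : Set (Fin n → A)) : Prop :=
  (∃ x ∈ admStrings p n, K = {y | y ∈ admStrings p n ∧ Communicate p n x y}) ∧
    ∀ x ∈ K, ∀ y, MarkovEdge p n x y → y ∈ K

/-- Every state of `K` has period one. -/
def IsAperiodicClass (p : ProbKernel A) (n : ℕ) (K : Set (Fin n → A)) : Prop :=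
  ∀ x ∈ K, ∀ d : ℕ, (∀ k : ℕ, 1 ≤ k → ReachIn p n k x x → d ∣ k) → d = 1

/-- The orders `n` with `β_n > 0` whose Markov chain has exactly one closed communicating class,
this class being aperiodic. -/
def goodOrders (p : ProbKernel A) : Set ℕ :=
  {n | 1 ≤ n ∧ 0 < betaN p n ∧
    ∃ K, IsClosedClass p n K ∧ (∀ K', IsClosedClass p n K' → K' = K) ∧ IsAperiodicClass p n K}

/-- `n̂`, where `n̂ < ∞` means that `goodOrders p` is nonempty. -/
def nhat (p : ProbKernel A) : ℕ := sInf (goodOrders p)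

/-- The standing assumption on the kernel (the alphabet is finite by its type):
`β = 0` and `n̂ < ∞`. -/
def StandingAssumption (p : ProbKernel A) : Prop :=
  beta p [] = 0 ∧ (goodOrders p).Nonempty

/-- The set `C` of admissible strings of length `n̂`. -/
abbrev stringsC (p : ProbKernel A) : Set (Fin (nhat p) → A) := admStrings p (nhat p)

/-- The closed class `U` of the Markov chain of order `n̂`, written as the union of all closed
classes, of which there is exactly one under the standing assumption. -/
def closedClass (p : ProbKernel A) : Set (Fin (nhat p) → A) :=
  ⋃₀ {K | IsClosedClass p (nhat p) K}

/-- The weight `α(a_{-n} | x) α(a_{-(n-1)} | a_{-n} x) ⋯ α(a_{-1} | a_{-n}^{-2} x)` of the string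
`a` (most recent symbol first) after the string `x`. -/
def weight (p : ProbKernel A) (x : List (WithTop A)) : List A → ℝ
  | [] => 1
  | g :: w => alpha p g (w.map (fun s => (s : WithTop A)) ++ x) * weight p x w

open Classical in
/-- `ρ̃_n`. -/
def rhoTilde (p : ProbKernel A) (n : ℕ) : ℝ :=
  ∑ x : Fin (nhat p) → A with x ∈ closedClass p,
    ∑ a : Fin n → A, weight p (toStarList x) (List.ofFn a)

/-! ### The coupled construction in a window -/

variable [LinearOrder A]

/-- `inf {g ∈ A : u < ∑_{b ≤ g} α(b | w)}`, with `inf ∅ = *`. -/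
def pick (p : ProbKernel A) (w : List (WithTop A)) (u : ℝ) : WithTop A :=
  (Finset.univ.filter fun g : A => u < ∑ b with b ≤ g, alpha p b w).min

/-- `inf {g ∈ A : u < β(w) + ∑_{b ≤ g} (α(b | w') - α(b | w))}`, with `inf ∅ = *`: the update
of a symbol that is still unknown when its known past `w` is refined to `w'`. -/
def pickUpdate (p : ProbKernel A) (w w' : List (WithTop A)) (u : ℝ) : WithTop A :=
  (Finset.univ.filter fun g : A =>
    u < beta p w + ∑ b with b ≤ g, (alpha p b w' - alpha p b w)).min

/-- The string `(Y^a)_0^{i-1} a` produced from the past `a` in `i` steps with the numbers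
`u 0, …, u (i-1)`, most recent symbol first. -/
def trajHist (p : ProbKernel A) (a : List (WithTop A)) (u : ℕ → ℝ) : ℕ → List (WithTop A)
  | 0 => a
  | i + 1 => pick p (trajHist p a u i) (u i) :: trajHist p a u i

/-- The symbol `Y_i^a`. -/
def traj (p : ProbKernel A) (a : List (WithTop A)) (u : ℕ → ℝ) (i : ℕ) : WithTop A :=
  pick p (trajHist p a u i) (u i)

/-- The window length `n₀`: the least `m ≥ n̂` such that for every string `b` of the closed class,
with positive probability, all the trajectories, started from all the strings of `C`, have `b` as
the string of their last `n̂` symbols after `m` steps. -/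
def windowLength (p : ProbKernel A) {Ω : Type*} [MeasurableSpace Ω] (μ : Measure Ω)
    (U : ℤ → stringsC p → Ω → ℝ) : ℕ :=
  sInf {m | nhat p ≤ m ∧ ∀ b ∈ closedClass p,
    0 < μ {ω | ∀ a : stringsC p, ∀ i : Fin (nhat p),
      traj p (toStarList a.1) (fun n => U n a ω) (m - 1 - i) = (b i : WithTop A)}}

/-! ### The algorithm

`N` is the window length, `u m a` is the number used at time `m` by the trajectory with past
`a`. -/

/-- The first time `l_z` of the window `I_z = {(z-1)N+1, …, zN}`. -/
def winStart (N : ℕ) (z : ℤ) : ℤ := N * (z - 1) + 1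

/-- The index of the window that contains the time `m`. -/
def winIndex (N : ℕ) (m : ℤ) : ℤ := (m - 1) / N + 1

/-- The position of the time `m` in its window: `m = l_z + winPos N m`. -/
def winPos (N : ℕ) (m : ℤ) : ℕ := (m - winStart N (winIndex N m)).toNat

/-- The string `(X^a)_{l_z}^{m-1} a`, where `m` is in the window `I_z`. -/
def localHist (p : ProbKernel A) (N : ℕ) (u : ℤ → stringsC p → ℝ) (a : stringsC p) (m : ℤ) :
    List (WithTop A) :=
  trajHist p (toStarList a.1) (fun i => u (winStart N (winIndex N m) + i) a) (winPos N m)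

/-- The symbol `X^a_m` of the trajectory that is started from `a` before the window of `m`. -/
def localValue (p : ProbKernel A) (N : ℕ) (u : ℤ → stringsC p → ℝ) (a : stringsC p) (m : ℤ) :
    WithTop A :=
  pick p (localHist p N u a m) (u m a)

open Classical in
/-- The value at time `m` when its own window is the oldest one inspected: the common symbol of
all the trajectories if there is one, and `*` otherwise. -/
def coalesced (p : ProbKernel A) (N : ℕ) (u : ℤ → stringsC p → ℝ) (m : ℤ) : WithTop A :=
  if h : ∃ g : A, ∀ a : stringsC p, localValue p N u a m = (g : WithTop A) then (h.choose : A)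
  else ⊤

/-- The string `V_s^{s+k-1}`, most recent symbol first. -/
def segment (V : ℤ → WithTop A) (s : ℤ) (k : ℕ) : List (WithTop A) :=
  List.ofFn fun i : Fin k => V (s + k - 1 - (i : ℕ))

open Classical in
/-- The value `X_m^{(j)}`, where `V` holds the values `X^{(j+1)}` and `w` is the string
`(X^{(j)})_{l_j}^{m-1}`. -/
def newValue (p : ProbKernel A) (N : ℕ) (u : ℤ → stringsC p → ℝ) (j : ℤ) (V : ℤ → WithTop A)
    (m : ℤ) (w : List (WithTop A)) : WithTop A :=
  if winIndex N m = j then coalesced p N u m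
  else if V m ≠ ⊤ then V m
  else if h : ∃ b : stringsC p, (w.drop (winPos N m)).take (nhat p) = toStarList b.1 then
    -- the string of length `n̂` before the window of `m` is known and equal to `b`
    let b := h.choose
    if segment V (winStart N (winIndex N m) - nhat p) (nhat p) = toStarList b.1 then
      -- it was already known in the previous round
      pickUpdate p (segment V (winStart N (j + 1)) (m - winStart N (j + 1)).toNat) w (u m b)
    else if localValue p N u b m ≠ ⊤ then
      -- it has just become known: the trajectory started from `b` is kept and updated
      localValue p N u b m
    else pickUpdate p (localHist p N u b m) w (u m b)
  else ⊤

/-- The string `(X^{(j)})_{l_j}^{l_j+t-1}`, computed forward in time from `V = X^{(j+1)}`. -/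
def roundHist (p : ProbKernel A) (N : ℕ) (u : ℤ → stringsC p → ℝ) (j : ℤ) (V : ℤ → WithTop A) :
    ℕ → List (WithTop A)
  | 0 => []
  | t + 1 => newValue p N u j V (winStart N j + t) (roundHist p N u j V t) ::
      roundHist p N u j V t

/-- One round of the algorithm, with newest window `I_z`: from the values `V = X^{(j+1)}` to the
values `X^{(j)}`.  Times outside the windows `I_j, …, I_z` have the value `*`. -/
def roundValue (p : ProbKernel A) (N : ℕ) (u : ℤ → stringsC p → ℝ) (z j : ℤ)
    (V : ℤ → WithTop A) (m : ℤ) : WithTop A :=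
  if winStart N j ≤ m ∧ m ≤ N * z then
    newValue p N u j V m (roundHist p N u j V (m - winStart N j).toNat)
  else ⊤

/-- The values `X^{(z-k)}` held by the algorithm that starts with the window `I_z`, after it has
inspected the windows `I_z, I_{z-1}, …, I_{z-k}`. -/
def run (p : ProbKernel A) (N : ℕ) (u : ℤ → stringsC p → ℝ) (z : ℤ) : ℕ → ℤ → WithTop A
  | 0 => roundValue p N u z z (fun _ => ⊤)
  | k + 1 => roundValue p N u z (z - (k + 1)) (run p N u z k)

/-- The temporary value `X_m^{(j)}`, for `m` in a window `I_z` with `j ≤ z`. -/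
def tempValue (p : ProbKernel A) (N : ℕ) (u : ℤ → stringsC p → ℝ) (j m : ℤ) : WithTop A :=
  run p N u (winIndex N m) (winIndex N m - j).toNat m

/-- `T̃[m] = sup {j ≤ z : X_m^{(j)} ≠ *}` for `m` in the window `I_z`; it is `-∞` if there is no
such `j`. -/
def Ttilde (p : ProbKernel A) (N : ℕ) (u : ℤ → stringsC p → ℝ) (m : ℤ) : EReal :=
  sSup ((fun j : ℤ => ((j : ℝ) : EReal)) '' {j | j ≤ winIndex N m ∧ tempValue p N u j m ≠ ⊤})

/-- `T̃[m, n]`. -/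
def TtildeRange (p : ProbKernel A) (N : ℕ) (u : ℤ → stringsC p → ℝ) (m n : ℤ) : EReal :=
  ⨅ k ∈ Set.Icc m n, Ttilde p N u k

/-- The algorithm with input `k`, which samples `X_{-k}, …, X_0` starting from the window `I_0`,
stops: after some round none of these values is `*`. -/
def AlgorithmStops (p : ProbKernel A) (N : ℕ) (u : ℤ → stringsC p → ℝ) (k : ℕ) : Prop :=
  ∃ r : ℕ, ∀ i : ℕ, i ≤ k → run p N u 0 r (-(i : ℤ)) ≠ ⊤

end PerfectSim

end

noncomputable section

namespace PerfectSim

/-! ### Strings with unknown symbols -/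

section Strings

variable {A : Type*}

/-! Call it a success from window `I_j` to window `I_z` if all trajectories in `I_j` end with one
string `b` of the closed class and round `j` knows every later symbol up to the end of `I_z`. A
success settles every value between these windows, so both claims follow once, for each `z`, almost
surely some success ends at `I_z` and starts as far back as desired (`ae_exists_success`).

Probability of a success. Successive updates at a fixed time allot to each symbol `g` disjoint
intervals of numbers, whose lengths telescope to `α(g | known past)` (`stage_eq_refineValue`,
`volume_refineValue`). This needs the infima to increase as the past is refined. Because `inf ∅ =
0`, that in turn requires every known past to be compatible with an admissible history, which is
where add invariance enters (`exists_admissible_of_round`). After coupling at `b` and known symbols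
`w`, the known past refines `w b`, and the next number is independent of the earlier ones; so `g`
follows with conditional probability at least `α(g | w b)` (`alpha_mul_measure_le`). Multiplying
along strings and adding disjoint events bounds the probability of success over `M` symbols below by
`δ ρ̃_M` (`rhoTilde_mul_le_measure_success`). The constant `δ > 0` bounds the coupling
probabilities: by aperiodicity and uniqueness of the closed class, paths of one common length lead
from all of `C` to any `b`, so the window length exists (`exists_forall_reachIn`,
`windowLength_spec`), and stationarity makes `δ` uniform in the window.

Renewal. Since `ρ̃` is nonincreasing, its series also diverges along multiples of the window length.
Consider the most recent start of a success ending at `I_z`. A success from an older window contains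
one that ends just before this start, and the latter depends only on earlier numbers. Independence
yields a renewal inequality, and if successes had total probability below one it would bound the
divergent series (`measureReal_iUnion_eq_one_of_renewal`). -/

lemma agrees_cons {x : WithTop A} {w : List (WithTop A)} {g : A} {a : ℕ → A}
    (hx : ∀ c : A, x = c → g = c) (hw : Agrees w a) : Agrees (x :: w) (consPast g a) := by
  rintro (_ | j) c hc
  · exact hx c (by simpa using hc)
  · exact hw j c (by simpa using hc)

lemma agrees_cons_iff {x : WithTop A} {w : List (WithTop A)} {a : ℕ → A} :
    Agrees (x :: w) a ↔ (∀ c : A, x = c → a 0 = c) ∧ Agrees w (fun i => a (i + 1)) := by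
  constructor
  · intro h
    exact ⟨fun c hc => h 0 c (by simp [hc]), fun j c hc => h (j + 1) c (by simpa using hc)⟩
  · rintro ⟨h0, h⟩ (_ | j) c hc
    · exact h0 c (by simpa using hc)
    · exact h j c (by simpa using hc)

lemma toStarList_getElem? {n : ℕ} (x : Fin n → A) (i : ℕ) (hi : i < n) :
    (toStarList x)[i]? = some (x ⟨i, hi⟩ : WithTop A) := by
  simp [toStarList, hi]

lemma toStarList_length {n : ℕ} (x : Fin n → A) : (toStarList x).length = n := by
  simp [toStarList]

lemma toStarList_injective {n : ℕ} : Function.Injective (toStarList : (Fin n → A) → _) := by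
  intro x y h
  have := List.ofFn_injective h
  funext i
  exact WithTop.coe_injective (congrFun this i)

lemma agrees_toStarList_iff {n : ℕ} (x : Fin n → A) (a : ℕ → A) :
    Agrees (toStarList x) a ↔ pastPrefix n a = x := by
  constructor
  · intro h
    funext i
    exact h i (x i) (toStarList_getElem? x i i.2)
  · rintro rfl j g hg
    have hj : j < n := by
      have := (List.getElem?_eq_some_iff.1 hg).1
      rwa [toStarList_length] at this
    rw [toStarList_getElem? _ j hj] at hg
    simpa [pastPrefix] using hg

end Strings

/-! ### Infima of the kernel -/

section Alpha

variable {A : Type*} [Fintype A] (p : ProbKernel A)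

/-- Some admissible history has the symbols prescribed by `w`. -/
def Compatible (w : List (WithTop A)) : Prop := ∃ a ∈ admissible p, Agrees w a

variable {p}

lemma alpha_nonneg (g : A) (w : List (WithTop A)) : 0 ≤ alpha p g w := by
  apply Real.sInf_nonneg
  rintro _ ⟨a, -, rfl⟩
  exact p.prob_nonneg g a

lemma alpha_le_prob (g : A) {w : List (WithTop A)} {a : ℕ → A} (ha : a ∈ admissible p)
    (hw : Agrees w a) : alpha p g w ≤ p.prob g a := by
  apply csInf_le
  · exact ⟨0, by rintro _ ⟨a, -, rfl⟩; exact p.prob_nonneg g a⟩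
  · exact ⟨a, ⟨ha, hw⟩, rfl⟩

/-- Fewer histories give a larger infimum. Compatibility of the finer string cannot be dropped: an
incompatible one has `α = 0` by the convention for the empty set. -/
lemma alpha_mono (g : A) {w w' : List (WithTop A)} (hc : Compatible p w')
    (h : ∀ a, Agrees w' a → Agrees w a) : alpha p g w ≤ alpha p g w' := by
  obtain ⟨a, ha, haw⟩ := hc
  apply csInf_le_csInf
  · exact ⟨0, by rintro _ ⟨a, -, rfl⟩; exact p.prob_nonneg g a⟩
  · exact ⟨_, a, ⟨ha, haw⟩, rfl⟩
  · rintro _ ⟨c, ⟨hc, hcw⟩, rfl⟩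
    exact ⟨c, ⟨hc, h c hcw⟩, rfl⟩

lemma beta_nonneg (w : List (WithTop A)) : 0 ≤ beta p w :=
  Finset.sum_nonneg fun g _ => alpha_nonneg g w

lemma beta_le_one (w : List (WithTop A)) : beta p w ≤ 1 := by
  by_cases hc : Compatible p w
  · obtain ⟨a, ha, haw⟩ := hc
    rw [← p.sum_prob a]
    exact Finset.sum_le_sum fun g _ => alpha_le_prob g ha haw
  · have : ∀ g, alpha p g w = 0 := by
      intro g
      have he : {a | a ∈ admissible p ∧ Agrees w a} = ∅ := by
        ext a
        simp only [Set.mem_ofPred_eq, Set.mem_empty_iff_false, iff_false]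
        exact fun h => hc ⟨a, h⟩
      simp [alpha, he]
    simp [beta, this]

lemma exists_prob_pos (a : ℕ → A) : ∃ g, 0 < p.prob g a := by
  by_contra! h
  have : ∑ g, p.prob g a ≤ 0 := Finset.sum_nonpos fun g _ => h g
  rw [p.sum_prob] at this
  linarith

end Alpha

/-! ### Inverting a cumulative sum -/

section Cut

variable {A : Type*} [Fintype A] [LinearOrder A]

/-- `inf {g : u < s + ∑_{c ≤ g} f c}`. -/
def cut (f : A → ℝ) (s u : ℝ) : WithTop A :=
  (Finset.univ.filter fun g : A => u < s + ∑ c with c ≤ g, f c).min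

lemma sum_lt_add (f : A → ℝ) (g : A) : ∑ c with c ≤ g, f c = ∑ c with c < g, f c + f g := by
  have : (Finset.univ.filter fun c : A => c ≤ g) =
      insert g (Finset.univ.filter fun c : A => c < g) := by
    ext c
    simp [le_iff_eq_or_lt]
  rw [this, Finset.sum_insert (by simp), add_comm]

/-- For nonnegative `f` the half-open intervals between consecutive partial sums tile `[s, s + ∑
f)`. -/
lemma cut_eq_coe_iff {f : A → ℝ} (hf : ∀ c, 0 ≤ f c) {s u : ℝ} (hs : s ≤ u) (g : A) :
    cut f s u = g ↔ s + ∑ c with c < g, f c ≤ u ∧ u < s + ∑ c with c ≤ g, f c := by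
  have key : (∀ c, c < g → s + ∑ x with x ≤ c, f x ≤ u) ↔ s + ∑ c with c < g, f c ≤ u := by
    constructor
    · intro h
      -- Either `g` is the least symbol, where the sum is empty and `s ≤ u` is used, or the strict
      -- sum below `g` is the weak sum up to its predecessor `m`.
      rcases (Finset.univ.filter fun c : A => c < g).eq_empty_or_nonempty with he | hne
      · simpa [he] using hs
      · have hm := Finset.max'_mem _ hne
        set m := (Finset.univ.filter fun c : A => c < g).max' hne with hmdef
        have hmg : m < g := by simpa using hm
        have : (Finset.univ.filter fun c : A => c < g) =
            (Finset.univ.filter fun c : A => c ≤ m) := by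
          ext c
          simp only [Finset.mem_filter, Finset.mem_univ, true_and]
          exact ⟨fun hc => Finset.le_max' _ _ (by simpa using hc), fun hc => hc.trans_lt hmg⟩
        rw [this]
        exact h m hmg
    · intro h c hc
      refine le_trans ?_ h
      refine add_le_add_right (Finset.sum_le_sum_of_subset_of_nonneg ?_ fun x _ _ => hf x) s
      exact Finset.monotone_filter_right _ fun _ _ hx => lt_of_le_of_lt hx hc
  rw [← key, cut]
  constructor
  · intro h
    refine ⟨fun c hc => ?_, ?_⟩
    · by_contra! hlt
      have := Finset.min_le (s := Finset.univ.filter fun g : A => u < s + ∑ c with c ≤ g, f c)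
        (a := c) (by simpa using hlt)
      rw [h, WithTop.coe_le_coe] at this
      exact absurd hc (not_lt.2 this)
    · simpa using Finset.mem_of_min h
  · rintro ⟨h1, h2⟩
    apply le_antisymm
    · exact Finset.min_le (by simpa using h2)
    · apply Finset.le_min
      intro c hc
      rw [WithTop.coe_le_coe]
      by_contra! hlt
      exact absurd (h1 c hlt) (not_le.2 (by simpa using hc))

lemma cut_eq_top_iff {f : A → ℝ} (hf : ∀ c, 0 ≤ f c) {s u : ℝ} (hs : s ≤ u) :
    cut f s u = ⊤ ↔ s + ∑ c, f c ≤ u := by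
  rw [cut, Finset.min_eq_top, Finset.filter_eq_empty_iff]
  constructor
  · intro h
    rcases isEmpty_or_nonempty A with hA | hA
    · simpa using hs
    · have hm : ∀ c : A, c ≤ Finset.univ.max' Finset.univ_nonempty :=
        fun c => Finset.le_max' _ _ (Finset.mem_univ c)
      have := h (Finset.mem_univ (Finset.univ.max' Finset.univ_nonempty))
      simpa [hm] using this
  · intro h g _
    rw [not_lt]
    refine le_trans ?_ h
    exact add_le_add_right (Finset.sum_le_sum_of_subset_of_nonneg (Finset.filter_subset _ _)
      fun x _ _ => hf x) s

variable {p : ProbKernel A}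

lemma pick_eq_cut (w : List (WithTop A)) (u : ℝ) :
    pick p w u = cut (fun c => alpha p c w) 0 u := by
  simp [pick, cut]

lemma pickUpdate_eq_cut (w w' : List (WithTop A)) (u : ℝ) :
    pickUpdate p w w' u = cut (fun c => alpha p c w' - alpha p c w) (beta p w) u := rfl

lemma alpha_pos_of_pick {w : List (WithTop A)} {u : ℝ} (hu : 0 ≤ u) {g : A}
    (h : pick p w u = g) : 0 < alpha p g w := by
  rw [pick_eq_cut, cut_eq_coe_iff (fun c => alpha_nonneg c w) hu, sum_lt_add] at h
  linarith [h.1, h.2]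

/-! ### Successive refinements of the known past -/

variable (p) in
/-- The symbol produced by the number `u` from the successive pasts `w₀` and `ws` (latest one
first): the symbol stays unknown until one of the pasts is rich enough. -/
def refineValue (w₀ : List (WithTop A)) : List (List (WithTop A)) → ℝ → WithTop A
  | [], u => pick p w₀ u
  | w' :: ws, u =>
    if refineValue w₀ ws u ≠ ⊤ then refineValue w₀ ws u else pickUpdate p (ws.headD w₀) w' u

variable (p) in
/-- The successive pasts `w₀` and `ws` (latest one first) have increasing infima. -/
def IncreasingInfima (w₀ : List (WithTop A)) : List (List (WithTop A)) → Prop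
  | [] => True
  | w' :: ws => (∀ c, alpha p c (ws.headD w₀) ≤ alpha p c w') ∧ IncreasingInfima w₀ ws

/-- Each update starts where the previous ones stopped, at `β` of the old past, and its increments
add up to the difference of the two values of `β`. Hence after every update exactly the numbers in
`[0, β(latest past))` are used up. -/
lemma refineValue_eq_top_iff {w₀ : List (WithTop A)} {ws : List (List (WithTop A))}
    (h : IncreasingInfima p w₀ ws) {u : ℝ} (hu : 0 ≤ u) :
    refineValue p w₀ ws u = ⊤ ↔ beta p (ws.headD w₀) ≤ u := by
  induction ws with
  | nil =>
    rw [refineValue, pick_eq_cut, cut_eq_top_iff (fun c => alpha_nonneg c w₀) hu]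
    simp [beta]
  | cons w' ws ih =>
    have hb : beta p (ws.headD w₀) ≤ beta p w' := Finset.sum_le_sum fun c _ => h.1 c
    have ih := ih h.2
    rw [refineValue]
    by_cases hv : refineValue p w₀ ws u = ⊤
    · rw [if_neg (by simpa using hv), pickUpdate_eq_cut,
        cut_eq_top_iff (fun c => sub_nonneg.2 (h.1 c)) (ih.1 hv), Finset.sum_sub_distrib]
      simp [beta]
    · rw [if_pos hv]
      constructor
      · exact fun h' => absurd h' hv
      · intro h'
        exact ih.2 (hb.trans h')

/-- The numbers for which the symbol `g` is produced from the pasts `w₀` and `ws` form a finite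
union of disjoint intervals, of total length `α(g | w)` for the latest past `w`. -/
lemma volume_refineValue {w₀ : List (WithTop A)} {ws : List (List (WithTop A))}
    (h : IncreasingInfima p w₀ ws) (g : A) :
    MeasurableSet {u : ℝ | 0 ≤ u ∧ refineValue p w₀ ws u = g} ∧
      {u : ℝ | 0 ≤ u ∧ refineValue p w₀ ws u = g} ⊆ Set.Ico 0 1 ∧
      volume {u : ℝ | 0 ≤ u ∧ refineValue p w₀ ws u = g} =
        ENNReal.ofReal (alpha p g (ws.headD w₀)) := by
  have hsub : {u : ℝ | 0 ≤ u ∧ refineValue p w₀ ws u = g} ⊆ Set.Ico 0 1 := by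
    rintro u ⟨hu, hg⟩
    refine ⟨hu, ?_⟩
    have := (refineValue_eq_top_iff h hu).not.1 (by simp [hg])
    exact (not_le.1 this).trans_le (beta_le_one _)
  refine (and_left_comm.1 ⟨hsub, ?_⟩)
  clear hsub
  induction ws with
  | nil =>
    have : {u : ℝ | 0 ≤ u ∧ refineValue p w₀ [] u = g} =
        Set.Ico (∑ c with c < g, alpha p c w₀) (∑ c with c ≤ g, alpha p c w₀) := by
      ext u
      simp only [refineValue, pick_eq_cut, Set.mem_ofPred_eq, Set.mem_Ico]
      constructor
      · rintro ⟨hu, hg⟩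
        simpa using (cut_eq_coe_iff (fun c => alpha_nonneg c w₀) hu g).1 hg
      · rintro ⟨h1, h2⟩
        have hu : 0 ≤ u := (Finset.sum_nonneg fun c _ => alpha_nonneg c w₀).trans h1
        exact ⟨hu, (cut_eq_coe_iff (fun c => alpha_nonneg c w₀) hu g).2 (by simp [h1, h2])⟩
    rw [this]
    refine ⟨measurableSet_Ico, ?_⟩
    rw [Real.volume_Ico, sum_lt_add]
    simp
  | cons w' ws ih =>
    have ih := ih h.2
    set f := fun c => alpha p c w' - alpha p c (ws.headD w₀) with hf
    have hf0 : ∀ c, 0 ≤ f c := fun c => sub_nonneg.2 (h.1 c)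
    -- The update adds to the numbers that give `g` one interval of length `α(g | w') - α(g | w)`.
    -- It is disjoint from the old ones, which lie below `β` of the old past.
    have hset : {u : ℝ | 0 ≤ u ∧ refineValue p w₀ (w' :: ws) u = g} =
        {u : ℝ | 0 ≤ u ∧ refineValue p w₀ ws u = g} ∪
        Set.Ico (beta p (ws.headD w₀) + ∑ c with c < g, f c)
          (beta p (ws.headD w₀) + ∑ c with c ≤ g, f c) := by
      ext u
      simp only [refineValue, pickUpdate_eq_cut, Set.mem_ofPred_eq, Set.mem_Ico, Set.mem_union]
      constructor
      · rintro ⟨hu, hg⟩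
        by_cases hv : refineValue p w₀ ws u = ⊤
        · rw [if_neg (by simpa using hv)] at hg
          exact Or.inr ((cut_eq_coe_iff hf0 ((refineValue_eq_top_iff h.2 hu).1 hv) g).1 hg)
        · rw [if_pos hv] at hg
          exact Or.inl ⟨hu, hg⟩
      · rintro (⟨hu, hg⟩ | ⟨h1, h2⟩)
        · refine ⟨hu, ?_⟩
          rw [if_pos (by simp [hg]), hg]
        · have hs : beta p (ws.headD w₀) ≤ u :=
            (le_add_of_nonneg_right (Finset.sum_nonneg fun c _ => hf0 c)).trans h1
          have hu : 0 ≤ u := (beta_nonneg _).trans hs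
          refine ⟨hu, ?_⟩
          rw [if_neg (by simpa using (refineValue_eq_top_iff h.2 hu).2 hs)]
          exact (cut_eq_coe_iff hf0 hs g).2 ⟨h1, h2⟩
    rw [hset]
    refine ⟨ih.1.union measurableSet_Ico, ?_⟩
    rw [measure_union _ measurableSet_Ico, ih.2, Real.volume_Ico, sum_lt_add,
      ← ENNReal.ofReal_add (alpha_nonneg _ _)]
    · congr 1
      simp [hf]
    · rw [← add_assoc, add_sub_cancel_left]
      exact hf0 g
    · rw [Set.disjoint_left]
      rintro u ⟨hu, hg⟩ ⟨h1, -⟩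
      have := (refineValue_eq_top_iff h.2 hu).not.1 (by simp [hg])
      exact this ((le_add_of_nonneg_right (Finset.sum_nonneg fun c _ => hf0 c)).trans h1)

/-- Only nonempty intervals produce symbols, and later infima are at least as large. Hence a
produced symbol has positive probability after every admissible history that agrees with the latest
past. -/
lemma alpha_pos_of_refineValue {w₀ : List (WithTop A)} {ws : List (List (WithTop A))}
    (h : IncreasingInfima p w₀ ws) {u : ℝ} (hu : 0 ≤ u) {g : A}
    (hg : refineValue p w₀ ws u = g) : 0 < alpha p g (ws.headD w₀) := by
  induction ws with
  | nil => exact alpha_pos_of_pick hu hg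
  | cons w' ws ih =>
    rw [refineValue] at hg
    by_cases hv : refineValue p w₀ ws u = ⊤
    · rw [if_neg (by simpa using hv), pickUpdate_eq_cut,
        cut_eq_coe_iff (fun c => sub_nonneg.2 (h.1 c)) ((refineValue_eq_top_iff h.2 hu).1 hv),
        sum_lt_add] at hg
      have := alpha_nonneg (p := p) g (ws.headD w₀)
      simp only [List.headD_cons]
      linarith [hg.1, hg.2]
    · rw [if_pos hv] at hg
      exact (ih h.2 hg).trans_le (h.1 g)

lemma refineValue_of_pick {w₀ : List (WithTop A)} (ws : List (List (WithTop A))) {u : ℝ}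
    (hu : pick p w₀ u ≠ ⊤) : refineValue p w₀ ws u = pick p w₀ u := by
  induction ws with
  | nil => rfl
  | cons w' ws ih =>
    rw [refineValue, if_pos (by rwa [ih]), ih]

end Cut

/-! ### Segments of a two-sided string -/

section Segments

variable {A : Type*}

lemma segment_length (V : ℤ → WithTop A) (s : ℤ) (k : ℕ) : (segment V s k).length = k := by
  simp [segment]

lemma segment_getElem? (V : ℤ → WithTop A) (s : ℤ) {k i : ℕ} (hi : i < k) :
    (segment V s k)[i]? = some (V (s + k - 1 - i)) := by
  simp [segment, hi]

lemma segment_succ (V : ℤ → WithTop A) (s : ℤ) (k : ℕ) :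
    segment V s (k + 1) = V (s + k) :: segment V s k := by
  simp only [segment, List.ofFn_succ]
  congr 2
  · simp
    ring
  · funext i
    congr 1
    simp
    ring

lemma segment_congr {V V' : ℤ → WithTop A} {s : ℤ} {k : ℕ}
    (h : ∀ m, s ≤ m → m < s + k → V m = V' m) : segment V s k = segment V' s k := by
  simp only [segment]
  congr 1
  funext i
  have := i.2
  exact h _ (by omega) (by omega)

lemma segment_drop_take (V : ℤ → WithTop A) {s : ℤ} {t d n : ℕ} (h : d + n ≤ t) :
    ((segment V s t).drop d).take n = segment V (s + t - d - n) n := by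
  apply List.ext_getElem?
  intro i
  by_cases hi : i < n
  · rw [List.getElem?_take_of_lt hi, List.getElem?_drop, segment_getElem? V _ (by omega),
      segment_getElem? V _ hi]
    congr 2
    push_cast
    ring
  · rw [List.getElem?_eq_none (by simp; omega),
      List.getElem?_eq_none (by simp [segment_length]; omega)]

lemma agrees_segment_iff {V : ℤ → WithTop A} {s : ℤ} {k : ℕ} {a : ℕ → A} :
    Agrees (segment V s k) a ↔ ∀ i < k, ∀ g : A, V (s + k - 1 - i) = g → a i = g := by
  constructor
  · intro h i hi g hg
    exact h i g (by rw [segment_getElem? V s hi, hg])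
  · intro h i g hg
    have hi : i < k := by
      have := (List.getElem?_eq_some_iff.1 hg).1
      rwa [segment_length] at this
    rw [segment_getElem? V s hi] at hg
    exact h i hi g (by simpa using hg)

lemma segment_eq_toStarList_iff {V : ℤ → WithTop A} {s : ℤ} {n : ℕ} {x : Fin n → A} :
    segment V s n = toStarList x ↔ ∀ i : Fin n, V (s + n - 1 - (i : ℕ)) = x i := by
  rw [segment, toStarList, List.ofFn_inj, funext_iff]

end Segments

/-! ### Arithmetic of the windows -/

section Windows

variable {N : ℕ}

lemma winStart_succ (i : ℤ) : winStart N (i + 1) = winStart N i + N := by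
  simp only [winStart]
  ring

lemma winStart_eq (i : ℤ) : winStart N i = N * i - N + 1 := by
  simp only [winStart]
  ring

lemma winIndex_le_iff (hN : 0 < N) {m i : ℤ} : winIndex N m ≤ i ↔ m ≤ N * i := by
  have hN' : (0 : ℤ) < N := by exact_mod_cast hN
  rw [winIndex, ← Int.lt_iff_add_one_le, Int.ediv_lt_iff_lt_mul hN', mul_comm i]
  omega

lemma le_winIndex_iff (hN : 0 < N) {m i : ℤ} : i ≤ winIndex N m ↔ winStart N i ≤ m := by
  have := winIndex_le_iff hN (m := m) (i := i - 1)
  rw [winStart, ← not_lt, ← Int.le_sub_one_iff, this]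
  omega

lemma winStart_mono (N : ℕ) {i j : ℤ} (h : i ≤ j) : winStart N i ≤ winStart N j := by
  simp only [winStart]
  have : (N : ℤ) * (i - 1) ≤ N * (j - 1) := by gcongr
  omega

lemma winStart_le (hN : 0 < N) (m : ℤ) : winStart N (winIndex N m) ≤ m :=
  (le_winIndex_iff hN).1 le_rfl

lemma le_winEnd (hN : 0 < N) (m : ℤ) : m ≤ N * winIndex N m :=
  (winIndex_le_iff hN).1 le_rfl

lemma winPos_cast (hN : 0 < N) (m : ℤ) :
    (winPos N m : ℤ) = m - winStart N (winIndex N m) := by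
  have := winStart_le hN m
  rw [winPos, Int.toNat_of_nonneg (by omega)]

lemma winIndex_eq_of (hN : 0 < N) {m i : ℤ} (h1 : winStart N i ≤ m) (h2 : m ≤ N * i) :
    winIndex N m = i :=
  le_antisymm ((winIndex_le_iff hN).2 h2) ((le_winIndex_iff hN).2 h1)

lemma winIndex_winStart (hN : 0 < N) (i : ℤ) : winIndex N (winStart N i) = i := by
  apply winIndex_eq_of hN le_rfl
  rw [winStart_eq]
  omega

lemma winStart_le_sub (N : ℕ) {i j : ℤ} (h : j < i) : winStart N j + N ≤ winStart N i := by
  rw [← winStart_succ]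
  exact winStart_mono N (by omega)

lemma winIndex_succ (hN : 0 < N) (m : ℤ) :
    winIndex N (m + 1) = winIndex N m ∨ m + 1 = winStart N (winIndex N (m + 1)) := by
  by_cases h : m + 1 ≤ N * winIndex N m
  · left
    exact winIndex_eq_of hN (by have := winStart_le hN m; omega) h
  · right
    have h1 := le_winEnd hN m
    have h2 : m + 1 = winStart N (winIndex N m + 1) := by
      rw [winStart]
      ring_nf
      omega
    rw [h2, winIndex_winStart hN]

end Windows

/-! ### The rounds of the algorithm -/

section Stages

variable {A : Type*} [Fintype A] [LinearOrder A] (p : ProbKernel A) (N : ℕ)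
  (u : ℤ → stringsC p → ℝ)

lemma localHist_winStart (hN : 0 < N) (a : stringsC p) (i : ℤ) :
    localHist p N u a (winStart N i) = toStarList a.1 := by
  have : winPos N (winStart N i) = 0 := by
    rw [winPos, winIndex_winStart hN]
    simp
  rw [localHist, this]
  rfl

lemma localHist_succ (hN : 0 < N) (a : stringsC p) {m : ℤ}
    (h : winIndex N (m + 1) = winIndex N m) :
    localHist p N u a (m + 1) = localValue p N u a m :: localHist p N u a m := by
  have h1 : winPos N (m + 1) = winPos N m + 1 := by
    have h2 := winPos_cast hN (m + 1)
    have h3 := winPos_cast hN m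
    rw [h] at h2
    omega
  have h4 : winStart N (winIndex N m) + (winPos N m : ℤ) = m := by
    rw [winPos_cast hN]
    ring
  rw [localHist, h1, h, trajHist, h4]
  rfl

variable {p N u}

lemma localValue_eq_of_coalesced {m : ℤ} {g : A} (h : coalesced p N u m = g) (a : stringsC p) :
    localValue p N u a m = g := by
  rw [coalesced] at h
  split_ifs at h with hc
  · rw [← h]
    exact hc.choose_spec a
  · exact absurd h WithTop.top_ne_coe

lemma coalesced_eq {m : ℤ} {g : A} (a₀ : stringsC p)
    (h : ∀ a : stringsC p, localValue p N u a m = g) : coalesced p N u m = g := by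
  have hc : ∃ g : A, ∀ a : stringsC p, localValue p N u a m = (g : WithTop A) := ⟨g, h⟩
  rw [coalesced, dif_pos hc, ← hc.choose_spec a₀, h a₀]

lemma newValue_own {j m : ℤ} (h : winIndex N m = j) (V : ℤ → WithTop A)
    (w : List (WithTop A)) : newValue p N u j V m w = coalesced p N u m := by
  rw [newValue, if_pos h]

lemma newValue_of_ne_top {j m : ℤ} (h : winIndex N m ≠ j) {V : ℤ → WithTop A} (hV : V m ≠ ⊤)
    (w : List (WithTop A)) : newValue p N u j V m w = V m := by
  rw [newValue, if_neg h, if_pos hV]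

lemma newValue_of_unknown {j m : ℤ} (h : winIndex N m ≠ j) {V : ℤ → WithTop A}
    {w : List (WithTop A)}
    (hw : ¬∃ b : stringsC p, (w.drop (winPos N m)).take (nhat p) = toStarList b.1) :
    newValue p N u j V m w = V m := by
  rw [newValue, if_neg h]
  split_ifs with hV
  · rfl
  · exact (not_not.1 hV).symm

open Classical in
lemma newValue_of_known {j m : ℤ} (h : winIndex N m ≠ j) {V : ℤ → WithTop A} (hV : V m = ⊤)
    {w : List (WithTop A)} {b : stringsC p}
    (hw : (w.drop (winPos N m)).take (nhat p) = toStarList b.1) :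
    newValue p N u j V m w =
      if segment V (winStart N (winIndex N m) - nhat p) (nhat p) = toStarList b.1 then
        pickUpdate p (segment V (winStart N (j + 1)) (m - winStart N (j + 1)).toNat) w (u m b)
      else if localValue p N u b m ≠ ⊤ then localValue p N u b m
      else pickUpdate p (localHist p N u b m) w (u m b) := by
  have hc : ∃ b : stringsC p, (w.drop (winPos N m)).take (nhat p) = toStarList b.1 := ⟨b, hw⟩
  have hb : hc.choose = b := by
    apply Subtype.ext
    apply toStarList_injective
    rw [← hc.choose_spec, hw]
  rw [newValue, if_neg h, if_neg (by simpa using hV), dif_pos hc]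
  simp only [hb]

/-- The update is causal: it reads the previous round only up to time `m`. This permits comparing
runs with different newest windows. -/
lemma newValue_congr (hN : 0 < N) (j : ℤ) {V V' : ℤ → WithTop A} {m : ℤ}
    (h : ∀ m' ≤ m, V m' = V' m') (w : List (WithTop A)) :
    newValue p N u j V m w = newValue p N u j V' m w := by
  have h1 : segment V (winStart N (winIndex N m) - nhat p) (nhat p) =
      segment V' (winStart N (winIndex N m) - nhat p) (nhat p) := by
    apply segment_congr
    intro m' _ hm'
    have := winStart_le hN m
    exact h _ (by omega)
  have h2 : segment V (winStart N (j + 1)) (m - winStart N (j + 1)).toNat =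
      segment V' (winStart N (j + 1)) (m - winStart N (j + 1)).toNat := by
    apply segment_congr
    intro m' _ hm'
    exact h _ (by omega)
  simp only [newValue, h1, h2, h m le_rfl]

lemma roundHist_congr (hN : 0 < N) (j : ℤ) {V V' : ℤ → WithTop A} (t : ℕ)
    (h : ∀ m', m' < winStart N j + t → V m' = V' m') :
    roundHist p N u j V t = roundHist p N u j V' t := by
  induction t with
  | zero => rfl
  | succ t ih =>
    push_cast at h
    rw [roundHist, roundHist, ih fun m' hm' => h m' (by omega),
      newValue_congr hN j fun m' hm' => h m' (by omega)]

lemma roundHist_eq_segment (z j : ℤ) (V : ℤ → WithTop A) (t : ℕ)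
    (h : winStart N j + t ≤ N * z + 1) :
    roundHist p N u j V t = segment (roundValue p N u z j V) (winStart N j) t := by
  induction t with
  | zero => rfl
  | succ t ih =>
    push_cast at h
    rw [roundHist, segment_succ, ih (by omega), roundValue, if_pos (by constructor <;> omega),
      add_sub_cancel_left, Int.toNat_natCast, ih (by omega)]

variable (p N u)

/-- The temporary value `X_m^{(j)}`, which is `*` if the time `m` is before the window `I_j`. -/
def stage (j m : ℤ) : WithTop A := if j ≤ winIndex N m then tempValue p N u j m else ⊤

variable {p N u}

lemma stage_of_lt {j m : ℤ} (h : winIndex N m < j) : stage p N u j m = ⊤ := by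
  rw [stage, if_neg (by omega)]

lemma stage_eq_run {j m : ℤ} (h : j ≤ winIndex N m) :
    stage p N u j m = run p N u (winIndex N m) (winIndex N m - j).toNat m := by
  rw [stage, if_pos h, tempValue]

/-- The values held by the algorithm do not depend on the window from which it is started. -/
lemma run_eq_stage (hN : 0 < N) (k : ℕ) (z m : ℤ) (hm : m ≤ N * z) :
    run p N u z k m = stage p N u (z - k) m := by
  induction k using Nat.strong_induction_on generalizing z m with
  | _ k ih =>
  have hz := (winIndex_le_iff hN).2 hm
  have hmi : m ≤ N * winIndex N m := le_winEnd hN m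
  rcases lt_or_ge (winIndex N m) (z - k) with h | h
  · rw [stage_of_lt h]
    have hs : ¬ winStart N (z - k) ≤ m := by
      rw [← le_winIndex_iff hN]
      omega
    cases k with
    | zero =>
      rw [Nat.cast_zero, sub_zero] at hs
      rw [run, roundValue, if_neg fun h => hs h.1]
    | succ k =>
      push_cast at hs
      rw [run, roundValue, if_neg fun h => hs h.1]
  rw [stage_eq_run h]
  set i := winIndex N m with hi
  have hs : winStart N (z - k) ≤ m := (le_winIndex_iff hN).1 h
  -- One formula for the first and the later rounds; the `match` selects the values of the previous
  -- round.
  have hrun : ∀ (k : ℕ) (z : ℤ), winStart N (z - k) ≤ m → m ≤ N * z →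
      run p N u z k m = newValue p N u (z - k)
        (match k with | 0 => fun _ => ⊤ | k + 1 => run p N u z k) m
        (roundHist p N u (z - k) (match k with | 0 => fun _ => ⊤ | k + 1 => run p N u z k)
          (m - winStart N (z - k)).toNat) := by
    intro k z h1 h2
    cases k with
    | zero =>
      simp only [Nat.cast_zero, sub_zero] at h1 ⊢
      rw [run, roundValue, if_pos ⟨h1, h2⟩]
    | succ k =>
      push_cast at h1 ⊢
      rw [run, roundValue, if_pos ⟨h1, h2⟩]
  obtain ⟨d, hd⟩ : ∃ d : ℕ, i - (z - k) = d := ⟨(i - (z - k)).toNat, by omega⟩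
  have hdz : i - d = z - k := by omega
  rw [hd, Int.toNat_natCast, hrun k z hs hm, hrun d i (by rwa [hdz]) hmi, hdz]
  cases d with
  | zero => rw [newValue_own (by omega), newValue_own (by omega)]
  | succ d =>
    obtain ⟨e, rfl⟩ : ∃ e, k = e + 1 := ⟨k - 1, by omega⟩
    -- The two runs, one from `I_z` and one from the window of `m`, agree up to `m` one round
    -- earlier: both have fewer than `k` rounds there, so the induction hypothesis applies to each.
    have key : ∀ m' ≤ m, run p N u z e m' = run p N u i d m' := by
      intro m' hm'
      rw [ih e (by omega) z m' (by omega), ih d (by omega) i m' (by omega)]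
      congr 1
      push_cast at hdz
      omega
    simp only
    rw [newValue_congr hN _ key, roundHist_congr hN _ _ fun m' hm' => key m' (by omega)]

lemma stage_own (hN : 0 < N) (m : ℤ) : stage p N u (winIndex N m) m = coalesced p N u m := by
  rw [stage_eq_run le_rfl, sub_self, Int.toNat_zero, run, roundValue,
    if_pos ⟨winStart_le hN m, le_winEnd hN m⟩, newValue_own rfl]

variable (p N u) in
/-- The string `(X^{(j)})_{l_j}^{m-1}`. -/
def past (j m : ℤ) : List (WithTop A) :=
  segment (stage p N u j) (winStart N j) (m - winStart N j).toNat

variable (p N u) in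
/-- The string `(X^{(j)})_{l_i-n̂}^{l_i-1}` before the window `I_i` of `m`. -/
def entry (j m : ℤ) : List (WithTop A) :=
  segment (stage p N u j) (winStart N (winIndex N m) - nhat p) (nhat p)

/-- The recursion of the algorithm, free of the newest window: the run started at the window of `m`
already determines all values up to `m` in rounds `j` and `j + 1`. -/
lemma stage_rec (hN : 0 < N) {j m : ℤ} (h : j < winIndex N m) :
    stage p N u j m = newValue p N u j (stage p N u (j + 1)) m (past p N u j m) := by
  have hs : winStart N j ≤ m := (le_winIndex_iff hN).1 h.le
  have hmi : m ≤ N * winIndex N m := le_winEnd hN m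
  obtain ⟨d, hd⟩ : ∃ d : ℕ, winIndex N m - j = d + 1 := ⟨(winIndex N m - j - 1).toNat, by omega⟩
  have hj : winIndex N m - (d + 1) = j := by omega
  have hV : ∀ m' ≤ N * winIndex N m, run p N u (winIndex N m) d m' = stage p N u (j + 1) m' := by
    intro m' hm'
    rw [run_eq_stage hN _ _ _ hm']
    congr 1
    omega
  have hW : ∀ m' ≤ N * winIndex N m, roundValue p N u (winIndex N m) j
      (run p N u (winIndex N m) d) m' = stage p N u j m' := by
    intro m' hm'
    have := run_eq_stage (p := p) (u := u) hN (d + 1) _ _ hm'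
    rw [run] at this
    push_cast at this
    rwa [hj] at this
  rw [← hW m hmi, roundValue, if_pos ⟨hs, hmi⟩, newValue_congr hN j fun m' hm' => hV m' (by omega),
    roundHist_eq_segment (winIndex N m) j _ _ (by omega), past]
  congr 1
  exact segment_congr fun m' _ hm' => hW m' (by omega)

lemma past_drop_take (hN : 0 < N) (hn : nhat p ≤ N) {j m : ℤ} (h : j < winIndex N m) :
    ((past p N u j m).drop (winPos N m)).take (nhat p) = entry p N u j m := by
  have h1 := winStart_le_sub N h
  have h2 := winPos_cast hN m
  have h3 := winStart_le hN m
  rw [past, segment_drop_take _ (by omega), entry]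
  congr 1
  omega

lemma stage_succ_of_ne_top (hN : 0 < N) {j m : ℤ} (h : stage p N u (j + 1) m ≠ ⊤) :
    stage p N u j m = stage p N u (j + 1) m := by
  have hj : j < winIndex N m := by
    by_contra! hj
    exact h (stage_of_lt (by omega))
  rw [stage_rec hN hj, newValue_of_ne_top hj.ne' h]

lemma stage_of_unknown (hN : 0 < N) (hn : nhat p ≤ N) {j m : ℤ} (h : j < winIndex N m)
    (hb : ¬∃ b : stringsC p, entry p N u j m = toStarList b.1) :
    stage p N u j m = stage p N u (j + 1) m := by
  rw [stage_rec hN h, newValue_of_unknown h.ne' (by rwa [past_drop_take hN hn h])]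

open Classical in
lemma stage_of_known (hN : 0 < N) (hn : nhat p ≤ N) {j m : ℤ} (h : j < winIndex N m)
    (ht : stage p N u (j + 1) m = ⊤) {b : stringsC p} (hb : entry p N u j m = toStarList b.1) :
    stage p N u j m =
      if entry p N u (j + 1) m = toStarList b.1 then
        pickUpdate p (past p N u (j + 1) m) (past p N u j m) (u m b)
      else if localValue p N u b m ≠ ⊤ then localValue p N u b m
      else pickUpdate p (localHist p N u b m) (past p N u j m) (u m b) := by
  rw [stage_rec hN h, newValue_of_known h.ne' ht (by rwa [past_drop_take hN hn h])]
  rfl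

/-- As `n̂ ≥ 1`, the entry string includes the time just before the window, which is unknown until
an older window is inspected. -/
lemma entry_lt (hN : 0 < N) (h1 : 1 ≤ nhat p) {j m : ℤ} {b : Fin (nhat p) → A}
    (hb : entry p N u j m = toStarList b) : j < winIndex N m := by
  by_contra! hj
  rw [entry, segment_eq_toStarList_iff] at hb
  have h := hb ⟨0, h1⟩
  rw [stage_of_lt] at h
  · exact WithTop.top_ne_coe h
  · rw [← not_le, le_winIndex_iff hN]
    have := winStart_mono N hj
    push_cast
    omega

lemma entry_persist (hN : 0 < N) {j m : ℤ} {b : Fin (nhat p) → A}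
    (hb : entry p N u (j + 1) m = toStarList b) : entry p N u j m = toStarList b := by
  rw [entry, segment_eq_toStarList_iff] at hb ⊢
  intro i
  rw [stage_succ_of_ne_top hN, hb i]
  rw [hb i]
  exact WithTop.coe_ne_top

open Classical in
variable (p N u) in
/-- The pasts with which the symbol at time `m` has been updated since the string `b` before its
window is known, latest one first, `k` rounds after the window of `m` has been inspected. -/
def updates (b : stringsC p) (m : ℤ) : ℕ → List (List (WithTop A))
  | 0 => []
  | k + 1 =>
    if entry p N u (winIndex N m - (k + 1)) m = toStarList b.1 then
      past p N u (winIndex N m - (k + 1)) m :: updates b m k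
    else []

lemma updates_headD (hN : 0 < N) (h1 : 1 ≤ nhat p) {b : stringsC p} {m : ℤ} {k : ℕ}
    (hb : entry p N u (winIndex N m - k) m = toStarList b.1) (w : List (WithTop A)) :
    (updates p N u b m k).headD w = past p N u (winIndex N m - k) m := by
  cases k with
  | zero => exact absurd (entry_lt hN h1 hb) (by simp)
  | succ k =>
    push_cast at hb ⊢
    rw [updates, if_pos hb]
    rfl

lemma updates_of_ne (b : stringsC p) {m : ℤ} {k : ℕ}
    (hb : entry p N u (winIndex N m - k) m ≠ toStarList b.1) : updates p N u b m k = [] := by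
  cases k with
  | zero => rfl
  | succ k =>
    push_cast at hb
    rw [updates, if_neg hb]

/-- Induction over the rounds. Before the entry string is known, the value is the coalesced one.
When it becomes `b`, a coalesced symbol agrees with the trajectory from `b`, so the value is as if
this trajectory had been followed all along; each further round then adds one refinement. -/
lemma stage_eq_aux (hN : 0 < N) (h1 : 1 ≤ nhat p) (hn : nhat p ≤ N) (m : ℤ) (k : ℕ) :
    (∀ b : stringsC p, entry p N u (winIndex N m - k) m = toStarList b.1 →
      stage p N u (winIndex N m - k) m =
        refineValue p (localHist p N u b m) (updates p N u b m k) (u m b)) ∧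
    ((¬∃ b : stringsC p, entry p N u (winIndex N m - k) m = toStarList b.1) →
      stage p N u (winIndex N m - k) m = coalesced p N u m) := by
  induction k with
  | zero =>
    constructor
    · intro b hb
      exact absurd (entry_lt hN h1 hb) (by simp)
    · intro _
      simpa using stage_own hN m
  | succ k ih =>
    obtain ⟨ih1, ih2⟩ := ih
    push_cast
    have hj : winIndex N m - (k + 1 : ℤ) < winIndex N m := by omega
    have hj1 : winIndex N m - (k + 1 : ℤ) + 1 = winIndex N m - k := by ring
    set j := winIndex N m - (k + 1 : ℤ) with hjdef
    rw [← hj1] at ih1 ih2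
    constructor
    · intro b hb
      rw [updates, if_pos hb, refineValue]
      by_cases hb' : entry p N u (j + 1) m = toStarList b.1
      · rw [← ih1 b hb']
        split_ifs with ht
        · exact stage_succ_of_ne_top hN ht
        · rw [stage_of_known hN hn hj (not_not.1 ht) hb, if_pos hb',
            updates_headD hN h1 (by rwa [hj1] at hb'), hj1]
      · have hu : updates p N u b m k = [] := updates_of_ne b (by rwa [hj1] at hb')
        -- In the previous round no entry string was known: known symbols persist, so it would have
        -- been `b` as well.
        have hc := ih2 (by
          rintro ⟨b', hb''⟩
          have := entry_persist hN hb''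
          rw [hb] at this
          rw [this] at hb'
          exact hb' hb'')
        have hloc : refineValue p (localHist p N u b m) [] (u m b) = localValue p N u b m := rfl
        rw [hu, hloc, List.headD_nil]
        by_cases ht : stage p N u (j + 1) m = ⊤
        · rw [stage_of_known hN hn hj ht hb, if_neg hb']
        · obtain ⟨g, hg⟩ := WithTop.ne_top_iff_exists.1 ht
          have hl := localValue_eq_of_coalesced (hc.symm.trans hg.symm) b
          rw [stage_succ_of_ne_top hN ht, hl, if_pos WithTop.coe_ne_top, hg]
    · intro hb
      rw [stage_of_unknown hN hn hj hb]
      apply ih2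
      rintro ⟨b, hb'⟩
      exact hb ⟨b, entry_persist hN hb'⟩

/-- Once the string `b` before the window of `m` is known, the value at time `m` is produced by
the number `u m b` from the successive known pasts. -/
lemma stage_eq_refineValue (hN : 0 < N) (h1 : 1 ≤ nhat p) (hn : nhat p ≤ N) {j m : ℤ}
    {b : stringsC p} (hb : entry p N u j m = toStarList b.1) :
    stage p N u j m = refineValue p (localHist p N u b m)
      (updates p N u b m (winIndex N m - j).toNat) (u m b) := by
  have hj := entry_lt hN h1 hb
  have h : winIndex N m - ((winIndex N m - j).toNat : ℤ) = j := by omega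
  have := (stage_eq_aux hN h1 hn m (winIndex N m - j).toNat (u := u)).1 b
  rw [h] at this
  exact this hb

lemma stage_eq_coalesced (hN : 0 < N) (h1 : 1 ≤ nhat p) (hn : nhat p ≤ N) {j m : ℤ}
    (hj : j ≤ winIndex N m) (hb : ¬∃ b : stringsC p, entry p N u j m = toStarList b.1) :
    stage p N u j m = coalesced p N u m := by
  have h : winIndex N m - ((winIndex N m - j).toNat : ℤ) = j := by omega
  have := (stage_eq_aux hN h1 hn m (winIndex N m - j).toNat (u := u)).2
  rw [h] at this
  exact this hb

/-! ### Admissibility of the known pasts -/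

lemma past_succ {j m : ℤ} (h : winStart N j ≤ m) :
    past p N u j (m + 1) = stage p N u j m :: past p N u j m := by
  obtain ⟨t, ht⟩ : ∃ t : ℕ, m = winStart N j + t := ⟨(m - winStart N j).toNat, by omega⟩
  have h1 : (m + 1 - winStart N j).toNat = t + 1 := by omega
  have h2 : (m - winStart N j).toNat = t := by omega
  rw [past, past, h1, h2, segment_succ, ht]

lemma agrees_past_iff {j m : ℤ} {a : ℕ → A} :
    Agrees (past p N u j m) a ↔
      ∀ i : ℕ, winStart N j + i < m → ∀ g : A, stage p N u j (m - 1 - i) = g → a i = g := by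
  rw [past, agrees_segment_iff]
  constructor
  · intro h i hi g hg
    refine h i (by omega) g ?_
    rw [← hg]
    congr 1
    omega
  · intro h i hi g hg
    refine h i (by omega) g ?_
    rw [← hg]
    congr 1
    omega

lemma agrees_past_succ (hN : 0 < N) {j m : ℤ} {a : ℕ → A} (h : Agrees (past p N u j m) a) :
    Agrees (past p N u (j + 1) m) a := by
  rw [agrees_past_iff] at h ⊢
  intro i hi g hg
  refine h i ?_ g ?_
  · have := winStart_mono N (show j ≤ j + 1 by omega)
    omega
  · rw [stage_succ_of_ne_top hN, hg]
    rw [hg]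
    exact WithTop.coe_ne_top

lemma pastPrefix_of_agrees_past (hN : 0 < N) (h1 : 1 ≤ nhat p) (hn : nhat p ≤ N) {j i : ℤ}
    {b : Fin (nhat p) → A} (hb : entry p N u j (winStart N i) = toStarList b) {a : ℕ → A}
    (ha : Agrees (past p N u j (winStart N i)) a) : pastPrefix (nhat p) a = b := by
  have hj := entry_lt hN h1 hb
  rw [winIndex_winStart hN] at hj
  have hs := winStart_le_sub N hj
  rw [entry, segment_eq_toStarList_iff, winIndex_winStart hN] at hb
  rw [agrees_past_iff] at ha
  funext k
  have hk := k.2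
  refine ha k (by omega) _ ?_
  rw [← hb k]
  congr 1
  ring

lemma entry_eq_of_winIndex {j m m' : ℤ} (h : winIndex N m = winIndex N m') :
    entry p N u j m = entry p N u j m' := by
  rw [entry, entry, h]

/-- The known past refines the trajectory that is started from the string `b` before the
window. -/
lemma agrees_localHist (hN : 0 < N) (h1 : 1 ≤ nhat p) (hn : nhat p ≤ N) {j m : ℤ}
    {b : stringsC p} (hb : entry p N u j m = toStarList b.1) {a : ℕ → A}
    (ha : Agrees (past p N u j m) a) : Agrees (localHist p N u b m) a := by
  have hj := entry_lt hN h1 hb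
  have hm := winStart_le hN m
  generalize hi : winIndex N m = i at hj hm
  induction m, hm using Int.leInduction generalizing a with
  | base =>
    rw [localHist_winStart _ _ _ hN, agrees_toStarList_iff]
    exact pastPrefix_of_agrees_past hN h1 hn hb ha
  | succ m hm ih =>
    have hmi : winIndex N m = i := by
      apply winIndex_eq_of hN hm
      have := le_winEnd hN (m + 1)
      rw [hi] at this
      omega
    have hb' : entry p N u j m = toStarList b.1 := by
      rw [← hb]
      exact entry_eq_of_winIndex (by rw [hmi, hi])
    have hsm : winStart N j ≤ m := (winStart_mono N hj.le).trans hm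
    rw [past_succ hsm, agrees_cons_iff] at ha
    rw [localHist_succ _ _ _ hN _ (by rw [hmi, hi]), agrees_cons_iff]
    refine ⟨fun c hc => ha.1 c ?_, ih hb' ha.2 hmi⟩
    rw [stage_eq_refineValue hN h1 hn hb', refineValue_of_pick]
    · exact hc
    · change localValue p N u b m ≠ ⊤
      rw [hc]
      exact WithTop.coe_ne_top

/-- The first known past refines the trajectory from `b`, and each further round refines the
preceding past. Compatibility is assumed only for the last round and passes to the coarser pasts. -/
lemma increasingInfima_updates (hN : 0 < N) (h1 : 1 ≤ nhat p) (hn : nhat p ≤ N) {m : ℤ}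
    {b : stringsC p} {k : ℕ} (hb : entry p N u (winIndex N m - k) m = toStarList b.1)
    (hc : Compatible p (past p N u (winIndex N m - k) m)) :
    IncreasingInfima p (localHist p N u b m) (updates p N u b m k) := by
  induction k with
  | zero => trivial
  | succ k ih =>
    push_cast at hb hc
    have hj1 : winIndex N m - (k + 1 : ℤ) + 1 = winIndex N m - k := by ring
    rw [updates, if_pos hb]
    by_cases hb' : entry p N u (winIndex N m - k) m = toStarList b.1
    · have hpast : ∀ a, Agrees (past p N u (winIndex N m - (k + 1 : ℤ)) m) a →
          Agrees (past p N u (winIndex N m - k) m) a := by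
        intro a ha
        rw [← hj1]
        exact agrees_past_succ hN ha
      refine ⟨fun c => ?_, ih hb' ?_⟩
      · rw [updates_headD hN h1 hb']
        exact alpha_mono c hc hpast
      · obtain ⟨a, ha, haw⟩ := hc
        exact ⟨a, ha, hpast a haw⟩
    · rw [updates_of_ne b hb']
      exact ⟨fun c => alpha_mono c hc fun a ha => agrees_localHist hN h1 hn hb ha, trivial⟩

lemma pastPrefix_of_agrees_trajHist {n : ℕ} {x : Fin n → A} {v : ℕ → ℝ} {i : ℕ} {h : ℕ → A}
    (hx : Agrees (trajHist p (toStarList x) v i) h) : pastPrefix n (fun j => h (j + i)) = x := by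
  induction i generalizing h with
  | zero => exact (agrees_toStarList_iff x h).1 hx
  | succ i ih =>
    rw [trajHist, agrees_cons_iff] at hx
    rw [← ih hx.2]
    rfl

/-- The history is built forward in time. It has to follow a local trajectory too: while the entry
string is unknown, a known value is a coalesced symbol, and its positive probability after `h` is
visible only from the trajectory started at the string that `h` shows before the window. -/
lemma exists_admissible_of_round (hadd : AddInvariant p) (hN : 0 < N) (h1 : 1 ≤ nhat p)
    (hn : nhat p ≤ N) (hH : (admissible p).Nonempty) (hu : ∀ m a, 0 ≤ u m a) {j m : ℤ}
    (hm : winStart N j ≤ m) :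
    ∃ h ∈ admissible p, Agrees (past p N u j m) h ∧
      ∃ a : stringsC p, Agrees (localHist p N u a m) h := by
  -- At the beginning of a window the followed trajectory is replaced by the one started from the
  -- last `n̂` symbols of the history.
  have hboundary : ∀ i, ∀ h ∈ admissible p,
      ∃ a : stringsC p, Agrees (localHist p N u a (winStart N i)) h := by
    intro i h hh
    refine ⟨⟨pastPrefix (nhat p) h, h, hh, rfl⟩, ?_⟩
    rw [localHist_winStart _ _ _ hN, agrees_toStarList_iff]
  induction m, hm using Int.leInduction with
  | base =>
    obtain ⟨h, hh⟩ := hH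
    refine ⟨h, hh, ?_, hboundary j h hh⟩
    rw [agrees_past_iff]
    intro i hi
    omega
  | succ m hm ih =>
    obtain ⟨h, hh, hpast, a, ha⟩ := ih
    have hji : j ≤ winIndex N m := (le_winIndex_iff hN).2 hm
    have hloc : ∀ c : A, localValue p N u a m = c → 0 < p.prob c h := fun c hc =>
      (alpha_pos_of_pick (hu m a) hc).trans_le (alpha_le_prob c hh ha)
    have hstage : ∀ c : A, stage p N u j m = c →
        0 < p.prob c h ∧ ∀ c' : A, localValue p N u a m = c' → c = c' := by
      intro c hc
      by_cases hb : ∃ b : stringsC p, entry p N u j m = toStarList b.1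
      · obtain ⟨b, hb⟩ := hb
        -- The history fixes the string before the window, so the followed trajectory is the one
        -- that the algorithm uses.
        have hba : Agrees (localHist p N u b m) h := agrees_localHist hN h1 hn hb hpast
        have hab : a = b := Subtype.ext
          ((pastPrefix_of_agrees_trajHist ha).symm.trans (pastPrefix_of_agrees_trajHist hba))
        subst hab
        have heq := stage_eq_refineValue hN h1 hn hb
        have hk : winIndex N m - ((winIndex N m - j).toNat : ℤ) = j := by omega
        have hinc := increasingInfima_updates (k := (winIndex N m - j).toNat) hN h1 hn
          (by rwa [hk]) (by rw [hk]; exact ⟨h, hh, hpast⟩)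
        constructor
        · have := alpha_pos_of_refineValue hinc (hu m a) (heq.symm.trans hc)
          rw [updates_headD hN h1 (by rwa [hk]), hk] at this
          exact this.trans_le (alpha_le_prob c hh hpast)
        · intro c' hc'
          rw [refineValue_of_pick] at heq
          · apply WithTop.coe_injective
            rw [← hc, ← hc', heq]
            rfl
          · change localValue p N u a m ≠ ⊤
            rw [hc']
            exact WithTop.coe_ne_top
      · rw [stage_eq_coalesced hN h1 hn hji hb] at hc
        have hl := localValue_eq_of_coalesced hc a
        exact ⟨hloc c hl, fun c' hc' => WithTop.coe_injective (hl.symm.trans hc')⟩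
    -- The next symbol is the known value, else the symbol of the trajectory, else any symbol of
    -- positive probability; if both are known they coincide.
    obtain ⟨g, hg, hg1, hg2⟩ : ∃ g, 0 < p.prob g h ∧ (∀ c : A, stage p N u j m = c → g = c) ∧
        ∀ c : A, localValue p N u a m = c → g = c := by
      by_cases hs : stage p N u j m = ⊤
      · by_cases hl : localValue p N u a m = ⊤
        · obtain ⟨g, hg⟩ := exists_prob_pos (p := p) h
          refine ⟨g, hg, fun c hc => ?_, fun c hc => ?_⟩
          · exact absurd (hs.symm.trans hc) WithTop.top_ne_coe
          · exact absurd (hl.symm.trans hc) WithTop.top_ne_coe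
        · obtain ⟨g, hg⟩ := WithTop.ne_top_iff_exists.1 hl
          refine ⟨g, hloc g hg.symm, fun c hc => ?_, fun c hc => ?_⟩
          · exact absurd (hs.symm.trans hc) WithTop.top_ne_coe
          · exact WithTop.coe_injective (hg.trans hc)
      · obtain ⟨g, hg⟩ := WithTop.ne_top_iff_exists.1 hs
        exact ⟨g, (hstage g hg.symm).1, fun c hc => WithTop.coe_injective (hg.trans hc),
          (hstage g hg.symm).2⟩
    refine ⟨consPast g h, hadd h hh g hg, ?_, ?_⟩
    · rw [past_succ hm]
      exact agrees_cons hg1 hpast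
    · rcases winIndex_succ hN m with hw | hw
      · refine ⟨a, ?_⟩
        rw [localHist_succ _ _ _ hN _ hw]
        exact agrees_cons hg2 ha
      · rw [hw]
        exact hboundary _ _ (hadd h hh g hg)

lemma compatible_past (hadd : AddInvariant p) (hN : 0 < N) (h1 : 1 ≤ nhat p)
    (hn : nhat p ≤ N) (hH : (admissible p).Nonempty) (hu : ∀ m a, 0 ≤ u m a) {j m : ℤ}
    (hm : winStart N j ≤ m) : Compatible p (past p N u j m) := by
  obtain ⟨h, hh, hp, -⟩ := exists_admissible_of_round hadd hN h1 hn hH hu hm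
  exact ⟨h, hh, hp⟩

lemma mem_stringsC_of_entry (hadd : AddInvariant p) (hN : 0 < N) (h1 : 1 ≤ nhat p)
    (hn : nhat p ≤ N) (hH : (admissible p).Nonempty) (hu : ∀ m a, 0 ≤ u m a) {j m : ℤ}
    {b : Fin (nhat p) → A} (hb : entry p N u j m = toStarList b) : b ∈ stringsC p := by
  have hj := entry_lt hN h1 hb
  have hb' : entry p N u j (winStart N (winIndex N m)) = toStarList b := by
    rw [← hb]
    exact entry_eq_of_winIndex (winIndex_winStart hN _)
  obtain ⟨h, hh, hp⟩ := compatible_past hadd hN h1 hn hH hu (winStart_mono N hj.le)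
  exact ⟨h, hh, pastPrefix_of_agrees_past hN h1 hn hb' hp⟩

end Stages

/-! ### Measurability of functions with countably many values -/

section DiscreteMeasurable

variable {Ω τ τ' : Type*}

/-- All preimages under `f` are measurable. -/
def DiscreteMeasurable (𝓖 : MeasurableSpace Ω) (f : Ω → τ) : Prop :=
  ∀ s : Set τ, MeasurableSet[𝓖] (f ⁻¹' s)

variable {𝓖 : MeasurableSpace Ω}

lemma DiscreteMeasurable.const (c : τ) : DiscreteMeasurable 𝓖 fun _ : Ω => c :=
  fun s => by
    classical
    rw [Set.preimage_const]
    split_ifs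
    · exact MeasurableSet.univ
    · exact MeasurableSet.empty

lemma DiscreteMeasurable.map {f : Ω → τ} (hf : DiscreteMeasurable 𝓖 f) (φ : τ → τ') :
    DiscreteMeasurable 𝓖 fun ω => φ (f ω) :=
  fun s => hf (φ ⁻¹' s)

lemma DiscreteMeasurable.of_singleton [Countable τ] {f : Ω → τ}
    (hf : ∀ t, MeasurableSet[𝓖] {ω | f ω = t}) : DiscreteMeasurable 𝓖 f := by
  intro s
  have : f ⁻¹' s = ⋃ t ∈ s, {ω | f ω = t} := by
    ext ω
    simp
  rw [this]
  exact MeasurableSet.biUnion s.to_countable fun t _ => hf t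

/-- Splitting over the countably many values of `f` freezes it to a constant. In this way random
pasts may be inserted into `pick` and `pickUpdate`. -/
lemma DiscreteMeasurable.bind [Countable τ] {f : Ω → τ} (hf : DiscreteMeasurable 𝓖 f)
    {F : τ → Ω → τ'} (hF : ∀ t, DiscreteMeasurable 𝓖 (F t)) :
    DiscreteMeasurable 𝓖 fun ω => F (f ω) ω := by
  intro s
  have : (fun ω => F (f ω) ω) ⁻¹' s = ⋃ t, f ⁻¹' {t} ∩ F t ⁻¹' s := by
    ext ω
    simp
  rw [this]
  exact MeasurableSet.iUnion fun t => (hf _).inter (hF t s)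

lemma DiscreteMeasurable.setOf {P : Ω → Prop} (h : DiscreteMeasurable 𝓖 P) :
    MeasurableSet[𝓖] {ω | P ω} := by
  have := h {True}
  simpa [Set.preimage] using this

lemma DiscreteMeasurable.of_setOf {P : Ω → Prop} (h : MeasurableSet[𝓖] {ω | P ω}) :
    DiscreteMeasurable 𝓖 P := by
  apply DiscreteMeasurable.of_singleton
  intro t
  by_cases ht : t
  · simpa [ht] using h
  · simp only [ht, eq_iff_iff, iff_false]
    exact h.compl

lemma DiscreteMeasurable.forall {ι : Type*} [Countable ι] {P : ι → Ω → Prop}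
    (h : ∀ i, DiscreteMeasurable 𝓖 (P i)) : DiscreteMeasurable 𝓖 fun ω => ∀ i, P i ω := by
  apply DiscreteMeasurable.of_setOf
  rw [Set.ofPred_forall]
  exact MeasurableSet.iInter fun i => (h i).setOf

lemma DiscreteMeasurable.ite {P : Ω → Prop} {f g : Ω → τ} (hP : DiscreteMeasurable 𝓖 P)
    (hf : DiscreteMeasurable 𝓖 f) (hg : DiscreteMeasurable 𝓖 g) [DecidablePred P] :
    DiscreteMeasurable 𝓖 fun ω => if P ω then f ω else g ω := by
  intro s
  have : (fun ω => if P ω then f ω else g ω) ⁻¹' s =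
      ({ω | P ω} ∩ f ⁻¹' s) ∪ ({ω | P ω}ᶜ ∩ g ⁻¹' s) := by
    ext ω
    by_cases h : P ω <;> simp [h]
  rw [this]
  exact (hP.setOf.inter (hf s)).union (hP.setOf.compl.inter (hg s))

lemma DiscreteMeasurable.pi {ι : Type*} [Finite ι] [Countable τ] {f : ι → Ω → τ}
    (h : ∀ i, DiscreteMeasurable 𝓖 (f i)) : DiscreteMeasurable 𝓖 fun ω i => f i ω := by
  apply DiscreteMeasurable.of_singleton
  intro t
  have : {ω | (fun i => f i ω) = t} = ⋂ i, f i ⁻¹' {t i} := by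
    ext ω
    simp [funext_iff]
  rw [this]
  exact MeasurableSet.iInter fun i => h i _

lemma discreteMeasurable_segment {A : Type*} [Countable A] {V : Ω → ℤ → WithTop A} {s : ℤ} {k : ℕ}
    (h : ∀ m, s ≤ m → m < s + k → DiscreteMeasurable 𝓖 fun ω => V ω m) :
    DiscreteMeasurable 𝓖 fun ω => segment (V ω) s k := by
  have : Countable (WithTop A) := inferInstanceAs (Countable (Option A))
  induction k with
  | zero => exact DiscreteMeasurable.const []
  | succ k ih =>
    push_cast at h
    simp only [segment_succ]
    refine (h (s + k) (by omega) (by omega)).bind (F := fun x ω => x :: segment (V ω) s k)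
      fun x => (ih fun m h1 h2 => h m h1 (by omega)).map _

variable {A : Type*} [Fintype A] [LinearOrder A]

lemma discreteMeasurable_cut (f : A → ℝ) (s : ℝ) {X : Ω → ℝ} (hX : Measurable[𝓖] X) :
    DiscreteMeasurable 𝓖 fun ω => cut f s (X ω) := by
  have : DiscreteMeasurable 𝓖 fun ω =>
      (Finset.univ.filter fun g : A => X ω < s + ∑ c with c ≤ g, f c) := by
    apply DiscreteMeasurable.of_singleton
    intro F
    have : {ω | (Finset.univ.filter fun g : A => X ω < s + ∑ c with c ≤ g, f c) = F} =
        ⋂ g, {ω | X ω < s + ∑ c with c ≤ g, f c ↔ g ∈ F} := by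
      ext ω
      simp [Finset.ext_iff]
    rw [this]
    refine MeasurableSet.iInter fun g => ?_
    have hm : MeasurableSet[𝓖] {ω | X ω < s + ∑ c with c ≤ g, f c} := hX measurableSet_Iio
    by_cases hg : g ∈ F
    · simpa [hg] using hm
    · simp only [hg, iff_false]
      exact hm.compl
  exact this.map Finset.min

variable {p : ProbKernel A}

lemma discreteMeasurable_pick {w : Ω → List (WithTop A)} (hw : DiscreteMeasurable 𝓖 w)
    {X : Ω → ℝ} (hX : Measurable[𝓖] X) :
    DiscreteMeasurable 𝓖 fun ω => pick p (w ω) (X ω) := by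
  have : Countable (WithTop A) := inferInstanceAs (Countable (Option A))
  refine hw.bind (F := fun w ω => pick p w (X ω)) fun w => ?_
  simp only [pick_eq_cut]
  exact discreteMeasurable_cut _ _ hX

lemma discreteMeasurable_pickUpdate {w w' : Ω → List (WithTop A)}
    (hw : DiscreteMeasurable 𝓖 w) (hw' : DiscreteMeasurable 𝓖 w') {X : Ω → ℝ}
    (hX : Measurable[𝓖] X) :
    DiscreteMeasurable 𝓖 fun ω => pickUpdate p (w ω) (w' ω) (X ω) := by
  have : Countable (WithTop A) := inferInstanceAs (Countable (Option A))
  refine hw.bind (F := fun w ω => pickUpdate p w (w' ω) (X ω)) fun w => ?_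
  refine hw'.bind (F := fun w' ω => pickUpdate p w w' (X ω)) fun w' => ?_
  simp only [pickUpdate_eq_cut]
  exact discreteMeasurable_cut _ _ hX

end DiscreteMeasurable

/-! ### Measurability and locality of the values -/

section Measurability

variable {Ω A : Type*} {𝓖 : MeasurableSpace Ω} [Fintype A] [LinearOrder A] {p : ProbKernel A}
  {N : ℕ} {U : ℤ → stringsC p → Ω → ℝ}

lemma discreteMeasurable_trajHist (x : List (WithTop A)) {v : ℕ → Ω → ℝ} {k : ℕ}
    (hv : ∀ i < k, Measurable[𝓖] (v i)) :
    DiscreteMeasurable 𝓖 fun ω => trajHist p x (fun i => v i ω) k := by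
  have : Countable (WithTop A) := inferInstanceAs (Countable (Option A))
  induction k with
  | zero => exact DiscreteMeasurable.const _
  | succ k ih =>
    simp only [trajHist]
    refine (ih fun i hi => hv i (by omega)).bind (F := fun w ω => pick p w (v k ω) :: w)
      fun w => ?_
    exact (discreteMeasurable_pick (.const w) (hv k (by omega))).map (· :: w)

lemma discreteMeasurable_localHist (hN : 0 < N) {a : stringsC p} {m : ℤ}
    (hU : ∀ m' a, winStart N (winIndex N m) ≤ m' → m' < m → Measurable[𝓖] (U m' a)) :
    DiscreteMeasurable 𝓖 fun ω => localHist p N (fun m a => U m a ω) a m :=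
  discreteMeasurable_trajHist _ (v := fun i => U (winStart N (winIndex N m) + i) a) fun i hi => by
    have hc := winPos_cast hN m
    exact hU _ a (by omega) (by omega)

lemma discreteMeasurable_localValue (hN : 0 < N) {a : stringsC p} {m : ℤ}
    (hU : ∀ m' a, winStart N (winIndex N m) ≤ m' → m' ≤ m → Measurable[𝓖] (U m' a)) :
    DiscreteMeasurable 𝓖 fun ω => localValue p N (fun m a => U m a ω) a m :=
  discreteMeasurable_pick
    (discreteMeasurable_localHist hN fun m' a h1 h2 => hU m' a h1 h2.le)
    (hU m a (winStart_le hN m) le_rfl)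

open Classical in
lemma discreteMeasurable_coalesced (hN : 0 < N) {m : ℤ}
    (hU : ∀ m' a, winStart N (winIndex N m) ≤ m' → m' ≤ m → Measurable[𝓖] (U m' a)) :
    DiscreteMeasurable 𝓖 fun ω => coalesced p N (fun m a => U m a ω) m := by
  have : Countable (WithTop A) := inferInstanceAs (Countable (Option A))
  exact (DiscreteMeasurable.pi fun a : stringsC p =>
    discreteMeasurable_localValue (a := a) hN hU).map fun v : stringsC p → WithTop A =>
      if h : ∃ g : A, ∀ a : stringsC p, v a = (g : WithTop A) then ((h.choose : A) : WithTop A)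
      else ⊤

lemma discreteMeasurable_newValue (hN : 0 < N) {j m : ℤ} (hj : j < winIndex N m)
    {V : Ω → ℤ → WithTop A} {w : Ω → List (WithTop A)}
    (hU : ∀ m' a, winStart N j ≤ m' → m' ≤ m → Measurable[𝓖] (U m' a))
    (hV : ∀ m' ≤ m, DiscreteMeasurable 𝓖 fun ω => V ω m') (hw : DiscreteMeasurable 𝓖 w) :
    DiscreteMeasurable 𝓖 fun ω => newValue p N (fun m a => U m a ω) j (V ω) m (w ω) := by
  have : Countable (WithTop A) := inferInstanceAs (Countable (Option A))
  have hsj := winStart_mono N hj.le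
  have hsm := winStart_le hN m
  have hU' : ∀ m' a, winStart N (winIndex N m) ≤ m' → m' ≤ m → Measurable[𝓖] (U m' a) :=
    fun m' a h1 h2 => hU m' a (hsj.trans h1) h2
  refine hw.bind (F := fun w ω => newValue p N (fun m a => U m a ω) j (V ω) m w) fun w => ?_
  simp only [newValue, if_neg hj.ne']
  refine ((hV m le_rfl).map (· ≠ ⊤)).ite (hV m le_rfl) ?_
  split_ifs with h
  · refine DiscreteMeasurable.ite ?_ ?_ (DiscreteMeasurable.ite ?_ ?_ ?_)
    · exact (discreteMeasurable_segment fun m' _ h2 => hV m' (by omega)).map (· = _)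
    · exact discreteMeasurable_pickUpdate
        (discreteMeasurable_segment fun m' _ h2 => hV m' (by omega)) (.const w)
        (hU' m _ hsm le_rfl)
    · exact (discreteMeasurable_localValue hN hU').map (· ≠ ⊤)
    · exact discreteMeasurable_localValue hN hU'
    · exact discreteMeasurable_pickUpdate
        (discreteMeasurable_localHist hN fun m' a h1 h2 => hU' m' a h1 h2.le) (.const w)
        (hU' m _ hsm le_rfl)
  · exact .const ⊤

/-- The value `X_m^{(j)}` is determined by the numbers used at the times from `l_j` to `m`. -/
lemma discreteMeasurable_stage (hN : 0 < N) {j m : ℤ}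
    (hU : ∀ m' a, winStart N j ≤ m' → m' ≤ m → Measurable[𝓖] (U m' a)) :
    DiscreteMeasurable 𝓖 fun ω => stage p N (fun m a => U m a ω) j m := by
  -- Double induction: the value in round `j` at time `m` uses round `j + 1` up to `m`, handled by
  -- induction on the number of rounds, and round `j` before `m`, handled by strong induction on the
  -- distance from `l_j`.
  suffices H : ∀ (k : ℕ) (j m : ℤ), winIndex N m - j < k →
      (∀ m' a, winStart N j ≤ m' → m' ≤ m → Measurable[𝓖] (U m' a)) →
      DiscreteMeasurable 𝓖 fun ω => stage p N (fun m a => U m a ω) j m from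
    H (winIndex N m - j + 1).toNat j m (by omega) hU
  clear hU j m
  intro k
  induction k with
  | zero =>
    intro j m h _
    simp only [stage_of_lt (show winIndex N m < j by omega)]
    exact .const ⊤
  | succ k ih =>
    intro j m hk hU
    obtain ⟨t, ht⟩ : ∃ t, t = (m - winStart N j).toNat := ⟨_, rfl⟩
    induction t using Nat.strong_induction_on generalizing m with
    | _ t iht =>
    rcases lt_trichotomy (winIndex N m) j with h | h | h
    · simp only [stage_of_lt h]
      exact .const ⊤
    · subst h
      simp only [stage_own hN]
      exact discreteMeasurable_coalesced hN hU
    · simp only [stage_rec hN h]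
      have hjm : winStart N j ≤ m := (le_winIndex_iff hN).1 h.le
      refine discreteMeasurable_newValue hN h hU (fun m' hm' => ?_) ?_
      · refine ih (j + 1) m' ?_ fun m'' a h1 h2 => hU m'' a ?_ (h2.trans hm')
        · have : winIndex N m' ≤ winIndex N m :=
            (winIndex_le_iff hN).2 (hm'.trans (le_winEnd hN m))
          omega
        · exact (winStart_mono N (by omega)).trans h1
      · refine discreteMeasurable_segment fun m' h1 h2 => ?_
        refine iht (m' - winStart N j).toNat (by omega) m' ?_
          (fun m'' a h3 h4 => hU m'' a h3 (by omega)) rfl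
        have : winIndex N m' ≤ winIndex N m := by
          have := le_winEnd hN m
          exact (winIndex_le_iff hN).2 (by omega)
        omega

lemma discreteMeasurable_past (hN : 0 < N) {j m : ℤ}
    (hU : ∀ m' a, winStart N j ≤ m' → m' < m → Measurable[𝓖] (U m' a)) :
    DiscreteMeasurable 𝓖 fun ω => past p N (fun m a => U m a ω) j m :=
  discreteMeasurable_segment fun m' h1 h2 =>
    discreteMeasurable_stage hN fun m'' a h3 h4 => hU m'' a h3 (by omega)

lemma discreteMeasurable_entry (hN : 0 < N) {j m : ℤ}
    (hU : ∀ m' a, winStart N j ≤ m' → m' < m → Measurable[𝓖] (U m' a)) :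
    DiscreteMeasurable 𝓖 fun ω => entry p N (fun m a => U m a ω) j m :=
  discreteMeasurable_segment fun m' h1 h2 =>
    discreteMeasurable_stage hN fun m'' a h3 h4 => hU m'' a h3 (by
      have := winStart_le hN m
      omega)

lemma discreteMeasurable_updates (hN : 0 < N) {b : stringsC p} {m : ℤ} {k : ℕ}
    (hU : ∀ m' a, winStart N (winIndex N m - k) ≤ m' → m' < m → Measurable[𝓖] (U m' a)) :
    DiscreteMeasurable 𝓖 fun ω => updates p N (fun m a => U m a ω) b m k := by
  have : Countable (WithTop A) := inferInstanceAs (Countable (Option A))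
  induction k with
  | zero => exact .const []
  | succ k ih =>
    push_cast at hU
    simp only [updates]
    refine DiscreteMeasurable.ite ((discreteMeasurable_entry hN hU).map (· = toStarList b.1)) ?_
      (.const [])
    refine (discreteMeasurable_past hN hU).bind
      (F := fun w ω => w :: updates p N (fun m a => U m a ω) b m k) fun w => ?_
    refine (ih fun m' a h1 h2 => hU m' a ?_ h2).map (w :: ·)
    exact (winStart_mono N (by omega)).trans h1

end Measurability

/-! ### Coupling and success -/

section Events

variable {A : Type*} [Fintype A] [LinearOrder A] (p : ProbKernel A) (N : ℕ)

/-- All the trajectories in the window `I_j` end with the string `b`. -/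
def Coupled (u : ℤ → stringsC p → ℝ) (j : ℤ) (b : Fin (nhat p) → A) : Prop :=
  ∀ (a : stringsC p) (i : Fin (nhat p)), localValue p N u a (N * j - (i : ℕ)) = b i

/-- All the trajectories in the window `I_j` end with the same string of the closed class, and
all the symbols from there to the end of the window `I_z` are known in round `j`. -/
def Success (u : ℤ → stringsC p → ℝ) (j z : ℤ) : Prop :=
  ∃ b ∈ closedClass p, Coupled p N u j b ∧
    ∀ m, winStart N (j + 1) ≤ m → m ≤ N * z → stage p N u j m ≠ ⊤

variable {p N}

lemma Success.mono {u : ℤ → stringsC p → ℝ} {j i z : ℤ} (h : Success p N u j z) (hi : i ≤ z) :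
    Success p N u j i := by
  obtain ⟨b, hb, hc, hs⟩ := h
  have : (N : ℤ) * i ≤ N * z := by gcongr
  exact ⟨b, hb, hc, fun m h1 h2 => hs m h1 (h2.trans this)⟩

lemma discreteMeasurable_coupled {Ω : Type*} {𝓖 : MeasurableSpace Ω}
    {U : ℤ → stringsC p → Ω → ℝ} (hN : 0 < N) (hn : nhat p ≤ N) {j : ℤ} {b : Fin (nhat p) → A}
    (hU : ∀ m a, winStart N j ≤ m → m ≤ N * j → Measurable[𝓖] (U m a)) :
    DiscreteMeasurable 𝓖 fun ω => Coupled p N (fun m a => U m a ω) j b := by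
  refine DiscreteMeasurable.forall fun a => DiscreteMeasurable.forall fun i => ?_
  have hi := i.2
  have hw : winIndex N (N * j - (i : ℕ)) = j :=
    winIndex_eq_of hN (by rw [winStart_eq]; omega) (by omega)
  refine (discreteMeasurable_localValue hN fun m' a h1 h2 => hU m' a ?_ (by omega)).map (· = _)
  rwa [hw] at h1

lemma discreteMeasurable_success {Ω : Type*} {𝓖 : MeasurableSpace Ω}
    {U : ℤ → stringsC p → Ω → ℝ} (hN : 0 < N) (hn : nhat p ≤ N) {j z : ℤ} (hjz : j ≤ z)
    (hU : ∀ m a, winStart N j ≤ m → m ≤ N * z → Measurable[𝓖] (U m a)) :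
    DiscreteMeasurable 𝓖 fun ω => Success p N (fun m a => U m a ω) j z := by
  have hz : (N : ℤ) * j ≤ N * z := by gcongr
  apply DiscreteMeasurable.of_setOf
  have : {ω | Success p N (fun m a => U m a ω) j z} =
      ⋃ b ∈ closedClass p, {ω | Coupled p N (fun m a => U m a ω) j b} ∩
        ⋂ m ∈ Set.Icc (winStart N (j + 1)) (N * z),
          {ω | stage p N (fun m a => U m a ω) j m ≠ ⊤} := by
    ext ω
    simp only [Success, Set.mem_ofPred_eq, Set.mem_iUnion, Set.mem_inter_iff, Set.mem_iInter,
      Set.mem_Icc, and_imp, exists_prop]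
  rw [this]
  refine MeasurableSet.biUnion (Set.to_countable _) fun b _ => MeasurableSet.inter ?_ ?_
  · exact (discreteMeasurable_coupled hN hn fun m a h1 h2 => hU m a h1 (h2.trans hz)).setOf
  · refine MeasurableSet.biInter (Set.to_countable _) fun m hm => ?_
    exact ((discreteMeasurable_stage hN fun m' a h1 h2 =>
      hU m' a h1 (h2.trans hm.2)).map (· ≠ ⊤)).setOf

/-! ### Stationarity -/

variable {u : ℤ → stringsC p → ℝ}

lemma winStart_shift (j s : ℤ) : winStart N (j + s) = winStart N j + N * s := by
  simp only [winStart]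
  ring

lemma winIndex_shift (hN : 0 < N) (m s : ℤ) : winIndex N (m + N * s) = winIndex N m + s := by
  apply winIndex_eq_of hN
  · rw [winStart_shift]
    have := winStart_le hN m
    omega
  · have := le_winEnd hN m
    rw [mul_add]
    omega

lemma winPos_shift (hN : 0 < N) (m s : ℤ) : winPos N (m + N * s) = winPos N m := by
  rw [winPos, winPos, winIndex_shift hN, winStart_shift]
  congr 1
  ring

lemma localHist_shift (hN : 0 < N) (s : ℤ) (a : stringsC p) (m : ℤ) :
    localHist p N (fun m a => u (m + N * s) a) a m = localHist p N u a (m + N * s) := by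
  rw [localHist, localHist, winPos_shift hN, winIndex_shift hN, winStart_shift]
  congr 1
  funext i
  congr 1
  ring

lemma localValue_shift (hN : 0 < N) (s : ℤ) (a : stringsC p) (m : ℤ) :
    localValue p N (fun m a => u (m + N * s) a) a m = localValue p N u a (m + N * s) := by
  rw [localValue, localValue, localHist_shift hN]

open Classical in
lemma coalesced_shift (hN : 0 < N) (s m : ℤ) :
    coalesced p N (fun m a => u (m + N * s) a) m = coalesced p N u (m + N * s) := by
  have h : ∀ f g : stringsC p → WithTop A, f = g →
      (if h : ∃ c : A, ∀ a, f a = c then ((h.choose : A) : WithTop A) else ⊤) =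
        if h : ∃ c : A, ∀ a, g a = c then ((h.choose : A) : WithTop A) else ⊤ := by
    rintro f _ rfl
    rfl
  exact h _ _ (funext fun a => localValue_shift hN s a m)

omit [Fintype A] [LinearOrder A] in
lemma segment_shift (V : ℤ → WithTop A) (c s : ℤ) (k : ℕ) :
    segment (fun m => V (m + c)) s k = segment V (s + c) k := by
  simp only [segment]
  congr 1
  funext i
  congr 1
  ring

lemma newValue_shift (hN : 0 < N) (s j : ℤ) (V : ℤ → WithTop A) (m : ℤ)
    (w : List (WithTop A)) :
    newValue p N (fun m a => u (m + N * s) a) j (fun m => V (m + N * s)) m w =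
      newValue p N u (j + s) V (m + N * s) w := by
  have h1 : winIndex N m + s = j + s ↔ winIndex N m = j := by omega
  have h2 : winStart N (j + s + 1) = winStart N (j + 1) + N * s := by
    rw [← winStart_shift]
    congr 1
    ring
  have h3 : winStart N (winIndex N m) + N * s - (nhat p : ℤ) =
    winStart N (winIndex N m) - nhat p + N * s := by ring
  have h4 : m + N * s - (winStart N (j + 1) + N * s) = m - winStart N (j + 1) := by ring
  rw [newValue, newValue, winPos_shift hN]
  simp only [coalesced_shift hN, winIndex_shift hN, segment_shift,
    localValue_shift hN, localHist_shift hN, h1, h2, h3, h4, winStart_shift (winIndex N m)]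

lemma roundHist_shift (hN : 0 < N) (s j : ℤ) (V : ℤ → WithTop A) (t : ℕ) :
    roundHist p N (fun m a => u (m + N * s) a) j (fun m => V (m + N * s)) t =
      roundHist p N u (j + s) V t := by
  induction t with
  | zero => rfl
  | succ t ih =>
    have : winStart N j + N * s + (t : ℤ) = winStart N j + t + N * s := by ring
    rw [roundHist, roundHist, ih, newValue_shift hN, winStart_shift, this]

lemma roundValue_shift (hN : 0 < N) (s z j : ℤ) (V : ℤ → WithTop A) (m : ℤ) :
    roundValue p N (fun m a => u (m + N * s) a) z j (fun m => V (m + N * s)) m =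
      roundValue p N u (z + s) (j + s) V (m + N * s) := by
  have h1 : (winStart N j + N * s ≤ m + N * s ∧ m + N * s ≤ N * (z + s)) ↔
      (winStart N j ≤ m ∧ m ≤ N * z) := by
    rw [mul_add]
    omega
  have h2 : m + N * s - (winStart N j + N * s) = m - winStart N j := by ring
  simp only [roundValue, winStart_shift, h1, h2, newValue_shift hN, roundHist_shift hN]

lemma run_shift (hN : 0 < N) (s z : ℤ) (k : ℕ) (m : ℤ) :
    run p N (fun m a => u (m + N * s) a) z k m = run p N u (z + s) k (m + N * s) := by
  induction k generalizing m with
  | zero => exact roundValue_shift hN s z z (fun _ => ⊤) m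
  | succ k ih =>
    have h : z + s - ((k : ℤ) + 1) = z - (k + 1) + s := by ring
    rw [run, run, h, ← roundValue_shift hN, funext ih]

lemma stage_shift (hN : 0 < N) (s j m : ℤ) :
    stage p N (fun m a => u (m + N * s) a) j m = stage p N u (j + s) (m + N * s) := by
  have h : winIndex N m + s - (j + s) = winIndex N m - j := by ring
  simp only [stage, tempValue, winIndex_shift hN, run_shift hN, h, add_le_add_iff_right]

lemma success_shift (hN : 0 < N) (s j z : ℤ) :
    Success p N (fun m a => u (m + N * s) a) j z ↔ Success p N u (j + s) (z + s) := by
  have h1 : ∀ i : ℕ, (N : ℤ) * j + N * s - i = N * j - i + N * s := fun i => by ring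
  have h2 : j + s + 1 = j + 1 + s := by ring
  simp only [Success, Coupled, localValue_shift hN, stage_shift hN, h2, winStart_shift (j + 1),
    mul_add, h1]
  refine exists_congr fun b => and_congr_right fun _ => and_congr_right fun _ => ?_
  constructor
  · intro h m hm1 hm2
    simpa using h (m - N * s) (by omega) (by omega)
  · intro h m hm1 hm2
    exact h (m + N * s) (by omega) (by omega)

end Events

/-! ### Shift invariance of the law of the uniform numbers. -/

section Law

variable {A : Type*} [Fintype A] [LinearOrder A] {p : ProbKernel A}
  {Ω : Type*} [MeasurableSpace Ω] {μ : Measure Ω} [IsProbabilityMeasure μ]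
  {U : ℤ → stringsC p → Ω → ℝ}

omit [LinearOrder A] [IsProbabilityMeasure μ] in
/-- The law of the numbers is invariant under shifts of time. -/
lemma measure_shift (hmeas : ∀ m a, Measurable (U m a))
    (hunif : ∀ m a, μ.map (U m a) = volume.restrict (Set.Ico (0 : ℝ) 1))
    (hindep : iIndepFun (fun q : ℤ × stringsC p => U q.1 q.2) μ) (c : ℤ)
    {P : (ℤ → stringsC p → ℝ) → Prop}
    (hP : MeasurableSet {x : ℤ × stringsC p → ℝ | P fun m a => x (m, a)}) :
    μ {ω | P fun m a => U (m + c) a ω} = μ {ω | P fun m a => U m a ω} := by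
  have hinj : Function.Injective fun q : ℤ × stringsC p => (q.1 + c, q.2) := by
    rintro ⟨m, a⟩ ⟨m', a'⟩ h
    simpa using h
  have h1 := iIndepFun.map_fun_eq_infinitePi_map (X := fun q : ℤ × stringsC p => U q.1 q.2)
    (fun q => hmeas q.1 q.2) hindep
  have h2 := iIndepFun.map_fun_eq_infinitePi_map
    (X := fun q : ℤ × stringsC p => U (q.1 + c) q.2) (fun q => hmeas (q.1 + c) q.2)
    (hindep.precomp hinj)
  have h3 : μ.map (fun ω (q : ℤ × stringsC p) => U (q.1 + c) q.2 ω) =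
      μ.map (fun ω (q : ℤ × stringsC p) => U q.1 q.2 ω) := by
    rw [h1]
    refine h2.trans ?_
    congr 1
    funext q
    rw [hunif, hunif]
  have h4 := congrArg (fun ν => ν {x : ℤ × stringsC p → ℝ | P fun m a => x (m, a)}) h3
  rw [Measure.map_apply (by fun_prop) hP, Measure.map_apply (by fun_prop) hP] at h4
  exact h4

end Law

/-! ### The numbers used at different times are independent -/

section Sampling

variable {Ω : Type*} [MeasurableSpace Ω] {μ : Measure Ω}

/-- A number that is independent of a countably valued `W` falls into a set that depends on `W`
with probability at least the smallest measure of such a set. -/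
lemma le_measure_sample {Ω : Type*} {𝓖 m₀ : MeasurableSpace Ω} {μ : Measure Ω} {τ : Type*}
    [Countable τ] (h𝓖 : 𝓖 ≤ m₀) {W : Ω → τ} (hW : DiscreteMeasurable 𝓖 W) {X : Ω → ℝ}
    (hX : Measurable[m₀] X)
    (hind : Indep 𝓖 (MeasurableSpace.comap X inferInstance) μ) {E : Set Ω}
    (hE : MeasurableSet[𝓖] E) (S : τ → Set ℝ) (c : ENNReal)
    (h : ∀ t, μ (E ∩ W ⁻¹' {t}) ≠ 0 → MeasurableSet (S t) ∧ c ≤ μ.map X (S t)) :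
    c * μ E ≤ μ (E ∩ {ω | X ω ∈ S (W ω)}) := by
  classical
  -- Measurability of `S t` is assumed only for values `t` of positive probability; at the others `S
  -- t` is replaced by the empty set.
  set T : τ → Set ℝ := fun t => if μ (E ∩ W ⁻¹' {t}) = 0 then ∅ else S t with hT
  have hTm : ∀ t, MeasurableSet (T t) := by
    intro t
    simp only [hT]
    split_ifs with ht
    · exact MeasurableSet.empty
    · exact (h t ht).1
  have hEt : ∀ t, MeasurableSet[𝓖] (E ∩ W ⁻¹' {t}) := fun t => hE.inter (hW _)
  have hdisj : Pairwise (Function.onFun Disjoint fun t => E ∩ W ⁻¹' {t}) := by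
    intro t t' htt
    rw [Function.onFun, Set.disjoint_left]
    rintro ω ⟨-, h1⟩ ⟨-, h2⟩
    exact htt (h1.symm.trans h2)
  have hE' : E = ⋃ t, E ∩ W ⁻¹' {t} := by
    ext ω
    simp
  calc c * μ E = ∑' t, c * μ (E ∩ W ⁻¹' {t}) := by
        conv_lhs => rw [hE']
        rw [measure_iUnion hdisj fun t => h𝓖 _ (hEt t), ENNReal.tsum_mul_left]
    _ ≤ ∑' t, μ ((E ∩ W ⁻¹' {t}) ∩ X ⁻¹' T t) := by
        refine ENNReal.tsum_le_tsum fun t => ?_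
        rw [(Indep_iff _ _ _).1 hind _ _ (hEt t) ⟨T t, hTm t, rfl⟩, mul_comm]
        by_cases ht : μ (E ∩ W ⁻¹' {t}) = 0
        · simp [ht]
        · gcongr
          have := (h t ht).2
          rw [Measure.map_apply hX (h t ht).1] at this
          simpa [hT, ht] using this
    _ = μ (⋃ t, (E ∩ W ⁻¹' {t}) ∩ X ⁻¹' T t) := by
        rw [measure_iUnion]
        · exact fun t t' htt => (hdisj htt).mono Set.inter_subset_left Set.inter_subset_left
        · exact fun t => (h𝓖 _ (hEt t)).inter (hX (hTm t))
    _ ≤ μ (E ∩ {ω | X ω ∈ S (W ω)}) := by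
        apply measure_mono
        intro ω hω
        obtain ⟨t, ⟨hE, ht⟩, hXt⟩ := Set.mem_iUnion.1 hω
        refine ⟨hE, ?_⟩
        rw [Set.mem_preimage, Set.mem_singleton_iff] at ht
        rw [Set.mem_ofPred_eq, ht]
        simp only [hT, Set.mem_preimage] at hXt
        split_ifs at hXt with h0
        · exact absurd hXt (Set.notMem_empty _)
        · exact hXt

variable {A : Type*} [Fintype A] {p : ProbKernel A} {U : ℤ → stringsC p → Ω → ℝ}

/-- The σ-algebra generated by the numbers used at the times in `S`. -/
@[reducible] def timeSigma {Ω : Type*} (U : ℤ → stringsC p → Ω → ℝ) (S : Set ℤ) :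
    MeasurableSpace Ω :=
  ⨆ q ∈ {q : ℤ × stringsC p | q.1 ∈ S},
    MeasurableSpace.comap (U q.1 q.2) (inferInstance : MeasurableSpace ℝ)

omit [MeasurableSpace Ω] in
lemma measurable_timeSigma {S : Set ℤ} {m : ℤ} (hm : m ∈ S) (a : stringsC p) :
    Measurable[timeSigma U S] (U m a) := by
  rw [measurable_iff_comap_le]
  exact le_iSup₂_of_le (m, a) hm le_rfl

lemma timeSigma_le (hmeas : ∀ m a, Measurable (U m a)) (S : Set ℤ) :
    timeSigma U S ≤ ‹MeasurableSpace Ω› :=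
  iSup₂_le fun q _ => (hmeas q.1 q.2).comap_le

lemma indep_timeSigma (hmeas : ∀ m a, Measurable (U m a))
    (hindep : iIndepFun (fun q : ℤ × stringsC p => U q.1 q.2) μ) {S T : Set ℤ}
    (hST : Disjoint S T) : Indep (timeSigma U S) (timeSigma U T) μ := by
  refine indep_iSup_of_disjoint
    (m := fun q : ℤ × stringsC p => MeasurableSpace.comap (U q.1 q.2) inferInstance)
    (fun q => (hmeas q.1 q.2).comap_le) hindep ?_
  rw [Set.disjoint_left] at hST ⊢
  exact fun q h1 h2 => hST h1 h2

lemma ae_nonneg (hmeas : ∀ m a, Measurable (U m a))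
    (hunif : ∀ m a, μ.map (U m a) = volume.restrict (Set.Ico (0 : ℝ) 1)) :
    ∀ᵐ ω ∂μ, ∀ m a, 0 ≤ U m a ω := by
  rw [ae_all_iff]
  intro m
  rw [ae_all_iff]
  intro a
  have h : ∀ᵐ x ∂μ.map (U m a), 0 ≤ x := by
    rw [hunif, ae_restrict_iff' measurableSet_Ico]
    exact ae_of_all _ fun x hx => hx.1
  exact ae_of_ae_map (hmeas m a).aemeasurable h

/-- The numbers are nonnegative only almost surely, whereas the combinatorial lemmas need this at a
point; an event of positive probability contains such a point. -/
lemma exists_nonneg_of_measure_ne_zero (hmeas : ∀ m a, Measurable (U m a))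
    (hunif : ∀ m a, μ.map (U m a) = volume.restrict (Set.Ico (0 : ℝ) 1)) {E : Set Ω}
    (hE : μ E ≠ 0) : ∃ ω ∈ E, ∀ m a, 0 ≤ U m a ω :=
  ((frequently_ae_mem_iff.2 hE).and_eventually (ae_nonneg hmeas hunif)).exists

end Sampling

/-! ### The probability of a known string -/

section KnownString

variable {A : Type*} [Fintype A] [LinearOrder A] {p : ProbKernel A} {N : ℕ}

omit [Fintype A] [LinearOrder A] in
lemma segment_append (V : ℤ → WithTop A) (s : ℤ) (k t : ℕ) :
    segment V s (k + t) = segment V (s + k) t ++ segment V s k := by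
  induction t with
  | zero => simp [segment]
  | succ t ih =>
    rw [← add_assoc, segment_succ, ih, segment_succ, List.cons_append]
    congr 2
    push_cast
    ring

omit [Fintype A] [LinearOrder A] in
lemma ne_top_of_segment {V : ℤ → WithTop A} {s : ℤ} {k : ℕ} {l : List A}
    (h : segment V s k = l.map WithTop.some) {m : ℤ} (h1 : s ≤ m)
    (h2 : m < s + k) : V m ≠ ⊤ := by
  have h3 := segment_getElem? V s (i := (s + k - 1 - m).toNat) (k := k) (by omega)
  rw [h, List.getElem?_map] at h3
  have h4 : s + k - 1 - ((s + k - 1 - m).toNat : ℤ) = m := by omega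
  rw [h4] at h3
  obtain ⟨g, -, hg⟩ := Option.map_eq_some_iff.1 h3
  rw [← hg]
  exact WithTop.coe_ne_top

/-- The window `I_j` ends with the string `b` in all the trajectories, and the next symbols known
in round `j` are `w` (most recent symbol first). -/
def KnownString (p : ProbKernel A) (N : ℕ) (u : ℤ → stringsC p → ℝ) (j : ℤ)
    (b : Fin (nhat p) → A) (w : List A) : Prop :=
  Coupled p N u j b ∧
    segment (stage p N u j) (winStart N (j + 1)) w.length = w.map WithTop.some

omit [Fintype A] [LinearOrder A] in
lemma map_append_toStarList {n : ℕ} (w : List A) (b : Fin n → A) :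
    w.map WithTop.some ++ toStarList b =
      (w ++ List.ofFn b).map WithTop.some := by
  rw [List.map_append, List.map_ofFn]
  rfl

omit [LinearOrder A] in
lemma weight_cons (x : List (WithTop A)) (g : A) (w : List A) :
    weight p x (g :: w) = alpha p g (w.map WithTop.some ++ x) * weight p x w := by
  have h : ∀ w : List A, w.flatMap (fun a : A => [(a : WithTop A)]) = w.map WithTop.some := by
    intro w
    induction w with
    | nil => rfl
    | cons a w ih => simp [ih]
  have h' : (do let a ← w; pure (a : WithTop A)) = w.map WithTop.some := h w
  rw [weight, h', List.map_id']

/-- In its own round the window `I_j` holds the coalesced values, so coupling makes `b` the known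
string just before `l_{j+1}`. -/
lemma KnownString.segment_eq {u : ℤ → stringsC p → ℝ} {j : ℤ} {b : Fin (nhat p) → A}
    {w : List A} (h : KnownString p N u j b w) (hN : 0 < N) (hn : nhat p ≤ N)
    (a₀ : stringsC p) :
    segment (stage p N u j) (winStart N (j + 1) - nhat p) (nhat p + w.length) =
      w.map WithTop.some ++ toStarList b := by
  rw [segment_append, sub_add_cancel, h.2]
  congr 1
  rw [segment_eq_toStarList_iff]
  intro i
  have hi := i.2
  have h1 : winStart N (j + 1) - (nhat p : ℤ) + nhat p - 1 - (i : ℕ) = N * j - (i : ℕ) := by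
    simp only [winStart]
    ring
  have hw : winIndex N (N * j - (i : ℕ)) = j :=
    winIndex_eq_of hN (by rw [winStart_eq]; omega) (by omega)
  rw [h1]
  conv_lhs => rw [← hw, hw]
  have := stage_own (p := p) (u := u) hN (N * j - (i : ℕ))
  rw [hw] at this
  rw [this]
  exact coalesced_eq a₀ fun a => h.1 a i

variable {Ω : Type*} [MeasurableSpace Ω] {μ : Measure Ω}
  {U : ℤ → stringsC p → Ω → ℝ}

omit [MeasurableSpace Ω] in
lemma discreteMeasurable_knownString {𝓖 : MeasurableSpace Ω} (hN : 0 < N) (hn : nhat p ≤ N)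
    {j : ℤ} {b : Fin (nhat p) → A} {w : List A}
    (hU : ∀ m a, winStart N j ≤ m → m < winStart N (j + 1) + w.length →
      Measurable[𝓖] (U m a)) :
    DiscreteMeasurable 𝓖 fun ω => KnownString p N (fun m a => U m a ω) j b w := by
  apply DiscreteMeasurable.of_setOf
  have h1 := (discreteMeasurable_coupled (b := b) (j := j) hN hn fun m a h1 h2 => hU m a h1 (by
    simp only [winStart]
    ring_nf
    omega)).setOf
  have h2 : DiscreteMeasurable 𝓖 fun ω =>
      segment (stage p N (fun m a => U m a ω) j) (winStart N (j + 1)) w.length :=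
    discreteMeasurable_segment fun m _ h2 =>
      discreteMeasurable_stage hN fun m' a h3 h4 => hU m' a h3 (by omega)
  exact h1.inter (h2.map (· = w.map WithTop.some)).setOf

section

variable {u : ℤ → stringsC p → ℝ} {j : ℤ} {b : Fin (nhat p) → A} {w : List A}

lemma le_winIndex_next (hN : 0 < N) (j : ℤ) (k : ℕ) :
    j + 1 ≤ winIndex N (winStart N (j + 1) + k) :=
  (le_winIndex_iff hN).2 (by omega)

/-- The string before the window of the time that follows a known string is determined by this
string. -/
lemma KnownString.entry_eq (h : KnownString p N u j b w) (hN : 0 < N) (hn : nhat p ≤ N)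
    (a₀ : stringsC p) : entry p N u j (winStart N (j + 1) + w.length) =
      ((w.map WithTop.some ++ toStarList b).drop
        (winPos N (winStart N (j + 1) + w.length))).take (nhat p) := by
  have hi := winStart_mono N (le_winIndex_next hN j w.length)
  have hpos := winPos_cast hN (winStart N (j + 1) + w.length)
  rw [← h.segment_eq hN hn a₀, segment_drop_take _ (by omega), entry]
  congr 1
  push_cast
  omega

lemma KnownString.agrees (h : KnownString p N u j b w) (hN : 0 < N) (hn : nhat p ≤ N)
    (a₀ : stringsC p) {a : ℕ → A}
    (ha : Agrees (past p N u j (winStart N (j + 1) + w.length)) a) :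
    Agrees (w.map WithTop.some ++ toStarList b) a := by
  have hs := winStart_succ (N := N) j
  rw [← h.segment_eq hN hn a₀, agrees_segment_iff]
  rw [agrees_past_iff] at ha
  intro i hi g hg
  refine ha i (by omega) g ?_
  rw [← hg]
  congr 1
  push_cast
  omega

/-- The entry string lies inside the known string `w b`, because its window is `I_{j+1}` or a later
one; it belongs to `C` because known pasts are compatible with admissible histories. -/
lemma KnownString.exists_entry (h : KnownString p N u j b w) (hadd : AddInvariant p)
    (hN : 0 < N) (h1 : 1 ≤ nhat p) (hn : nhat p ≤ N) (a₀ : stringsC p)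
    (hH : (admissible p).Nonempty) (hu : ∀ m a, 0 ≤ u m a) : ∃ b' : stringsC p,
      entry p N u j (winStart N (j + 1) + w.length) = toStarList b'.1 := by
  have hi := winStart_mono N (le_winIndex_next hN j w.length)
  have hm := winStart_le hN (winStart N (j + 1) + w.length)
  have hne : ∀ i : Fin (nhat p), ∃ g : A, stage p N u j
      (winStart N (winIndex N (winStart N (j + 1) + w.length)) - nhat p + nhat p - 1 - (i : ℕ)) =
        g := by
    intro i
    have hi' := i.2
    have hseg := h.segment_eq hN hn a₀
    rw [map_append_toStarList] at hseg
    obtain ⟨g, hg⟩ := WithTop.ne_top_iff_exists.1 (ne_top_of_segment hseg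
      (m := winStart N (winIndex N (winStart N (j + 1) + w.length)) - nhat p + nhat p - 1
        - (i : ℕ)) (by omega) (by push_cast; omega))
    exact ⟨g, hg.symm⟩
  choose x hx using hne
  have hx' : entry p N u j (winStart N (j + 1) + w.length) = toStarList x :=
    segment_eq_toStarList_iff.2 hx
  exact ⟨⟨x, mem_stringsC_of_entry hadd hN h1 hn hH hu hx'⟩, hx'⟩

end

/-- The numbers before time `m` determine the trajectory and the list of updates, hence the set of
numbers that yield `g`. Its length is `α(g | past)`, at least `α(g | w b)` since the past refines `w
b`, and the number `U m b'` is independent of everything before `m`. -/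
lemma alpha_mul_measure_le (hadd : AddInvariant p) (hN : 0 < N) (h1 : 1 ≤ nhat p)
    (hn : nhat p ≤ N) (hH : (admissible p).Nonempty) (hmeas : ∀ m a, Measurable (U m a))
    (hunif : ∀ m a, μ.map (U m a) = volume.restrict (Set.Ico (0 : ℝ) 1))
    (hindep : iIndepFun (fun q : ℤ × stringsC p => U q.1 q.2) μ) (j : ℤ)
    (b : Fin (nhat p) → A) (g : A) (w : List A) :
    ENNReal.ofReal (alpha p g (w.map WithTop.some ++ toStarList b)) *
        μ {ω | KnownString p N (fun m a => U m a ω) j b w} ≤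
      μ {ω | KnownString p N (fun m a => U m a ω) j b (g :: w)} := by
  have : Countable (WithTop A) := inferInstanceAs (Countable (Option A))
  by_cases hE0 : μ {ω | KnownString p N (fun m a => U m a ω) j b w} = 0
  · simp [hE0]
  obtain ⟨a₀⟩ : Nonempty (stringsC p) := by
    obtain ⟨h₀, hh₀⟩ := hH
    exact ⟨⟨pastPrefix (nhat p) h₀, h₀, hh₀, rfl⟩⟩
  obtain ⟨m, hm⟩ : ∃ m, m = winStart N (j + 1) + (w.length : ℤ) := ⟨_, rfl⟩
  -- The entry string is a function of `w` and `b` alone, so one `b'`, found at a single outcome,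
  -- serves for all outcomes of the event. The number to be sampled is thus fixed in advance.
  obtain ⟨b', hb'⟩ : ∃ b' : stringsC p, ∀ ω, KnownString p N (fun m a => U m a ω) j b w →
      entry p N (fun m a => U m a ω) j m = toStarList b'.1 := by
    obtain ⟨ω, hω, hu⟩ := exists_nonneg_of_measure_ne_zero hmeas hunif hE0
    obtain ⟨b', hb'⟩ := KnownString.exists_entry hω hadd hN h1 hn a₀ hH hu
    refine ⟨b', fun ω' hω' => ?_⟩
    rw [hm, hω'.entry_eq hN hn a₀, ← KnownString.entry_eq hω hN hn a₀, hb']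
  have hjm : winStart N j ≤ m := by
    have := winStart_mono N (show j ≤ j + 1 by omega)
    omega
  obtain ⟨k, hk⟩ : ∃ k : ℕ, winIndex N m - (k : ℤ) = j := by
    have := le_winIndex_next hN j w.length
    rw [← hm] at this
    exact ⟨(winIndex N m - j).toNat, by omega⟩
  have hUm : ∀ m' a, m' < m → Measurable[timeSigma U (Set.Iio m)] (U m' a) :=
    fun m' a h => measurable_timeSigma (Set.mem_Iio.2 h) a
  have hEm : MeasurableSet[timeSigma U (Set.Iio m)]
      {ω | KnownString p N (fun m a => U m a ω) j b w} :=
    (discreteMeasurable_knownString hN hn fun m' a _ h2 => hUm m' a (by rwa [hm])).setOf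
  have hWloc : DiscreteMeasurable (timeSigma U (Set.Iio m))
      fun ω => localHist p N (fun m a => U m a ω) b' m :=
    discreteMeasurable_localHist hN fun m' a _ h2 => hUm m' a h2
  have hWupd : DiscreteMeasurable (timeSigma U (Set.Iio m))
      fun ω => updates p N (fun m a => U m a ω) b' m k :=
    discreteMeasurable_updates hN fun m' a _ h2 => hUm m' a h2
  have hW : DiscreteMeasurable (timeSigma U (Set.Iio m)) fun ω =>
      (localHist p N (fun m a => U m a ω) b' m, updates p N (fun m a => U m a ω) b' m k) :=
    hWloc.bind (F := fun x ω => (x, updates p N (fun m a => U m a ω) b' m k))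
      fun x => hWupd.map (fun y => (x, y))
  have hind : Indep (timeSigma U (Set.Iio m)) (MeasurableSpace.comap (U m b') inferInstance) μ :=
    indep_of_indep_of_le_right
      (indep_timeSigma hmeas hindep (S := Set.Iio m) (T := {m}) (by simp))
      (measurable_timeSigma (Set.mem_singleton m) b').comap_le
  refine (le_measure_sample (timeSigma_le hmeas _) hW (hmeas m b') hind hEm
    (fun t => {u | 0 ≤ u ∧ refineValue p t.1 t.2 u = g}) _ ?_).trans (measure_mono ?_)
  · intro t ht
    -- An outcome that realizes `t` with nonnegative numbers certifies that the pasts in `t` are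
    -- compatible and have increasing infima.
    obtain ⟨ω, ⟨hω, hωt⟩, hu⟩ := exists_nonneg_of_measure_ne_zero hmeas hunif ht
    rw [Set.mem_preimage, Set.mem_singleton_iff] at hωt
    have hb := hb' ω hω
    have hc := compatible_past hadd hN h1 hn hH hu hjm
    rw [← hk] at hb hc
    obtain ⟨hv1, hv2, hv3⟩ := volume_refineValue (increasingInfima_updates hN h1 hn hb hc) g
    rw [updates_headD hN h1 hb, hk] at hv3
    rw [hk] at hc
    rw [← hωt]
    refine ⟨hv1, ?_⟩
    rw [hunif, Measure.restrict_apply hv1, Set.inter_eq_left.2 hv2, hv3]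
    refine ENNReal.ofReal_le_ofReal (alpha_mono g hc fun a ha => ?_)
    rw [hm] at ha
    exact KnownString.agrees hω hN hn a₀ ha
  · rintro ω ⟨hω, -, hg⟩
    refine ⟨hω.1, ?_⟩
    have hk' : (winIndex N m - j).toNat = k := by omega
    have hst := stage_eq_refineValue hN h1 hn (hb' ω hω)
    rw [List.length_cons, segment_succ, hω.2, List.map_cons, ← hm, hst, hk']
    exact congrArg (· :: _) hg

lemma weight_mul_measure_le (hadd : AddInvariant p) (hN : 0 < N) (h1 : 1 ≤ nhat p)
    (hn : nhat p ≤ N) (hH : (admissible p).Nonempty) (hmeas : ∀ m a, Measurable (U m a))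
    (hunif : ∀ m a, μ.map (U m a) = volume.restrict (Set.Ico (0 : ℝ) 1))
    (hindep : iIndepFun (fun q : ℤ × stringsC p => U q.1 q.2) μ) (j : ℤ)
    (b : Fin (nhat p) → A) (w : List A) :
    ENNReal.ofReal (weight p (toStarList b) w) *
        μ {ω | Coupled p N (fun m a => U m a ω) j b} ≤
      μ {ω | KnownString p N (fun m a => U m a ω) j b w} := by
  induction w with
  | nil =>
    rw [weight, ENNReal.ofReal_one, one_mul]
    exact measure_mono fun ω hω => ⟨hω, rfl⟩
  | cons g w ih =>
    refine le_trans ?_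
      (alpha_mul_measure_le hadd hN h1 hn hH hmeas hunif hindep j b g w)
    rw [weight_cons, ENNReal.ofReal_mul (alpha_nonneg _ _), mul_assoc]
    gcongr

omit [LinearOrder A] in
lemma weight_nonneg (x : List (WithTop A)) (w : List A) : 0 ≤ weight p x w := by
  induction w with
  | nil => exact zero_le_one
  | cons g w ih =>
    rw [weight_cons]
    exact mul_nonneg (alpha_nonneg _ _) ih

/-- The probability of a success over `M` symbols is at least a constant times `ρ̃_M`. -/
lemma rhoTilde_mul_le_measure_success (hadd : AddInvariant p) (hN : 0 < N) (h1 : 1 ≤ nhat p)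
    (hn : nhat p ≤ N) (hH : (admissible p).Nonempty) (hmeas : ∀ m a, Measurable (U m a))
    (hunif : ∀ m a, μ.map (U m a) = volume.restrict (Set.Ico (0 : ℝ) 1))
    (hindep : iIndepFun (fun q : ℤ × stringsC p => U q.1 q.2) μ) {j z : ℤ} {M : ℕ}
    (hM : (M : ℤ) = N * (z - j)) {δ : ENNReal}
    (hδ : ∀ b ∈ closedClass p, δ ≤ μ {ω | Coupled p N (fun m a => U m a ω) j b}) :
    ENNReal.ofReal (rhoTilde p M) * δ ≤ μ {ω | Success p N (fun m a => U m a ω) j z} := by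
  classical
  obtain ⟨h₀, hh₀⟩ := hH
  -- With a trajectory at hand, coupling determines `b`, which makes the events for different `b`
  -- disjoint.
  let a₀ : stringsC p := ⟨pastPrefix (nhat p) h₀, h₀, hh₀, rfl⟩
  have hH : (admissible p).Nonempty := ⟨h₀, hh₀⟩
  have hz : winStart N (j + 1) + (M : ℤ) = N * z + 1 := by
    rw [hM]
    simp only [winStart]
    ring
  set I : Finset ((Fin (nhat p) → A) × (Fin M → A)) :=
    (Finset.univ.filter fun x => x ∈ closedClass p) ×ˢ Finset.univ with hI
  -- The events of distinct pairs of a closed-class string and a continuation of `M` symbols are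
  -- disjoint, and each of them is a success.
  have hsum : ∑ q ∈ I, μ {ω | KnownString p N (fun m a => U m a ω) j q.1 (List.ofFn q.2)} ≤
      μ {ω | Success p N (fun m a => U m a ω) j z} := by
    rw [← measure_biUnion_finset]
    · apply measure_mono
      intro ω hω
      simp only [Set.mem_iUnion] at hω
      obtain ⟨⟨b, a⟩, hq, hω⟩ := hω
      refine ⟨b, by simpa [hI] using hq, hω.1, fun m hm1 hm2 => ?_⟩
      exact ne_top_of_segment hω.2 hm1 (by rw [List.length_ofFn]; omega)
    · rintro ⟨b, a⟩ - ⟨b', a'⟩ - hne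
      rw [Function.onFun, Set.disjoint_left]
      rintro ω h h'
      apply hne
      have hb : b = b' := by
        funext i
        exact WithTop.coe_injective ((h.1 a₀ i).symm.trans (h'.1 a₀ i))
      have ha : a = a' := by
        have h2 := h.2
        have h2' := h'.2
        simp only [List.length_ofFn] at h2 h2'
        exact List.ofFn_injective
          (List.map_injective_iff.2 WithTop.coe_injective (h2.symm.trans h2'))
      rw [hb, ha]
    · exact fun q _ => (discreteMeasurable_knownString hN hn fun m a _ _ => hmeas m a).setOf
  refine le_trans ?_ hsum
  rw [rhoTilde, hI, Finset.sum_product, ENNReal.ofReal_sum_of_nonneg, Finset.sum_mul]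
  · refine Finset.sum_le_sum fun b hb => ?_
    rw [ENNReal.ofReal_sum_of_nonneg fun a _ => weight_nonneg _ _, Finset.sum_mul]
    refine Finset.sum_le_sum fun a _ => ?_
    refine le_trans ?_
      (weight_mul_measure_le hadd hN h1 hn hH hmeas hunif hindep j b (List.ofFn a))
    gcongr
    exact hδ b (by simpa using hb)
  · exact fun b _ => Finset.sum_nonneg fun a _ => weight_nonneg _ _

end KnownString

/-! ### The Markov chain of order `n̂` -/

section Markov

variable {A : Type*} [Fintype A] {p : ProbKernel A} {n : ℕ}

lemma ReachIn.trans {k l : ℕ} {x y z : Fin n → A} (h : ReachIn p n k x y)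
    (h' : ReachIn p n l y z) : ReachIn p n (k + l) x z := by
  induction k generalizing x with
  | zero =>
    obtain rfl : x = y := h
    rwa [zero_add]
  | succ k ih =>
    obtain ⟨w, hw, hk⟩ := h
    rw [Nat.add_right_comm]
    exact ⟨w, hw, ih hk⟩

lemma reachIn_succ_iff {k : ℕ} {x z : Fin n → A} :
    ReachIn p n (k + 1) x z ↔ ∃ y, ReachIn p n k x y ∧ MarkovEdge p n y z := by
  constructor
  · intro h
    induction k generalizing x with
    | zero =>
      obtain ⟨w, hw, hk⟩ := h
      obtain rfl : w = z := hk
      exact ⟨x, rfl, hw⟩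
    | succ k ih =>
      obtain ⟨w, hw, hk⟩ := h
      obtain ⟨y, hy, hyz⟩ := ih hk
      exact ⟨y, ⟨w, hw, hy⟩, hyz⟩
  · rintro ⟨y, hy, hyz⟩
    exact hy.trans (l := 1) ⟨z, hyz, rfl⟩

lemma ReachIn.mem {k : ℕ} {x y : Fin n → A} (h : ReachIn p n k x y) (hx : x ∈ admStrings p n) :
    y ∈ admStrings p n := by
  cases k with
  | zero =>
    obtain rfl : x = y := h
    exact hx
  | succ k =>
    obtain ⟨z, -, hz⟩ := reachIn_succ_iff.1 h
    exact hz.2.1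

/-- From every state of a finite Markov chain some closed class is reached. -/
lemma exists_isClosedClass {x : Fin n → A} (hx : x ∈ admStrings p n) :
    ∃ y k, ReachIn p n k x y ∧
      IsClosedClass p n {z | z ∈ admStrings p n ∧ Communicate p n y z} := by
  let R : (Fin n → A) → (Fin n → A) → Prop := fun x y => ∃ k, ReachIn p n k x y
  have hR : ∀ {x y z}, R x y → R y z → R x z := fun ⟨k, hk⟩ ⟨l, hl⟩ => ⟨k + l, hk.trans hl⟩
  -- Strict reachability is a well-founded relation on the finite state space. A minimal state
  -- reachable from `x` can be returned to from everything it reaches, so its class is closed.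
  let r : (Fin n → A) → (Fin n → A) → Prop := fun y x => R x y ∧ ¬R y x
  have : IsTrans (Fin n → A) r :=
    ⟨fun a b c h1 h2 => ⟨hR h2.1 h1.1, fun h => h1.2 (hR h h2.1)⟩⟩
  have : Std.Irrefl r := ⟨fun a h => h.2 h.1⟩
  obtain ⟨y, ⟨k, hk⟩, hmin⟩ := (Finite.wellFounded_of_trans_of_irrefl r).has_min {y | R x y}
    ⟨x, 0, rfl⟩
  have hy := hk.mem hx
  refine ⟨y, k, hk, ⟨y, hy, rfl⟩, ?_⟩
  rintro z ⟨hz, hyz, hzy⟩ w hzw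
  refine ⟨hzw.2.1, ?_⟩
  have hyw : R y w := hR hyz ⟨1, w, hzw, rfl⟩
  refine ⟨hyw, ?_⟩
  by_contra hwy
  exact hmin w (hR ⟨k, hk⟩ hyw) ⟨hyw, hwy⟩

/-- The return times form an additive semigroup with greatest common divisor one, and such a
semigroup contains all large integers. -/
lemma exists_forall_reachIn_self {x : Fin n → A}
    (h : ∀ d : ℕ, (∀ k : ℕ, 1 ≤ k → ReachIn p n k x x → d ∣ k) → d = 1) :
    ∃ T, ∀ k ≥ T, ReachIn p n k x x := by
  set s : Set ℕ := {k | 1 ≤ k ∧ ReachIn p n k x x}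
  have hs : Nat.setGcd s = 1 := h _ fun k h1 hk => Nat.setGcd_dvd_of_mem ⟨h1, hk⟩
  obtain ⟨T, hT⟩ := Nat.exists_mem_closure_of_ge s
  refine ⟨T, fun k hk => ?_⟩
  have hc := hT k hk (by rw [hs]; exact one_dvd k)
  clear hk
  induction hc using AddSubmonoid.closure_induction with
  | mem y hy => exact hy.2
  | zero => exact rfl
  | add y z _ _ hy hz => exact hy.trans hz

lemma exists_closedClass (hp : StandingAssumption p) : 1 ≤ nhat p ∧ (admissible p).Nonempty ∧
    IsClosedClass p (nhat p) (closedClass p) ∧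
    (∀ K', IsClosedClass p (nhat p) K' → K' = closedClass p) ∧
    IsAperiodicClass p (nhat p) (closedClass p) := by
  obtain ⟨h1, -, K, hK, huniq, hap⟩ : nhat p ∈ goodOrders p := Nat.sInf_mem hp.2
  have hcK : closedClass p = K := by
    rw [closedClass]
    apply Set.Subset.antisymm
    · refine Set.sUnion_subset fun K' hK' => ?_
      rw [huniq K' hK']
    · exact Set.subset_sUnion_of_mem hK
  refine ⟨h1, ?_, by rwa [hcK], by rwa [hcK], by rwa [hcK]⟩
  obtain ⟨⟨x, ⟨h, hh, -⟩, -⟩, -⟩ := hK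
  exact ⟨h, hh⟩

/-- After sufficiently many steps every state of the closed class is reached from every state. -/
lemma exists_forall_reachIn (hp : StandingAssumption p) :
    ∃ T, ∀ k ≥ T, ∀ a ∈ stringsC p, ∀ b ∈ closedClass p, ReachIn p (nhat p) k a b := by
  obtain ⟨-, -, ⟨⟨x, hx, hK⟩, -⟩, huniq, hap⟩ := exists_closedClass hp
  have hxK : x ∈ closedClass p := by
    rw [hK]
    exact ⟨hx, ⟨0, rfl⟩, ⟨0, rfl⟩⟩
  obtain ⟨T, hT⟩ := exists_forall_reachIn_self (hap x hxK)
  have hto : ∀ a : stringsC p, ∃ k, ReachIn p (nhat p) k a.1 x := by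
    rintro ⟨a, ha⟩
    obtain ⟨y, k, hk, hcl⟩ := exists_isClosedClass ha
    -- The closed class reached from `a` is the unique one, so it contains `x`.
    have hyK : x ∈ {z | z ∈ admStrings p (nhat p) ∧ Communicate p (nhat p) y z} := by
      rwa [huniq _ hcl]
    obtain ⟨-, ⟨l, hl⟩, -⟩ := hyK
    exact ⟨k + l, hk.trans hl⟩
  have hfrom : ∀ b : closedClass p, ∃ k, ReachIn p (nhat p) k x b.1 := by
    rintro ⟨b, hb⟩
    rw [hK] at hb
    exact hb.2.1
  choose t ht using hto
  choose s hs using hfrom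
  obtain ⟨B, hB⟩ := (Set.finite_range t).bddAbove
  obtain ⟨B', hB'⟩ := (Set.finite_range s).bddAbove
  -- A path from `a` to `x` has length at most `B`, one from `x` to `b` at most `B'`; a loop at `x`
  -- of the missing length, at least `T`, makes the total exactly `k`.
  refine ⟨B + T + B', fun k hk a ha b hb => ?_⟩
  have h1 : t ⟨a, ha⟩ ≤ B := hB ⟨_, rfl⟩
  have h2 : s ⟨b, hb⟩ ≤ B' := hB' ⟨_, rfl⟩
  have := ((ht ⟨a, ha⟩).trans (hT (k - t ⟨a, ha⟩ - s ⟨b, hb⟩) (by omega))).trans (hs ⟨b, hb⟩)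
  rwa [show t ⟨a, ha⟩ + (k - t ⟨a, ha⟩ - s ⟨b, hb⟩) + s ⟨b, hb⟩ = k by omega] at this

end Markov

/-! ### Coupling with positive probability -/

section Coupling

variable {A : Type*} [Fintype A] [LinearOrder A] {p : ProbKernel A}

lemma trajHist_getElem? (x : List (WithTop A)) (v : ℕ → ℝ) {i k : ℕ} (hi : i < k) :
    (trajHist p x v k)[i]? = some (traj p x v (k - 1 - i)) := by
  induction k generalizing i with
  | zero => omega
  | succ k ih =>
    rw [trajHist]
    rcases i with _ | i
    · simp [traj]
    · rw [List.getElem?_cons_succ, ih (by omega)]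
      congr 2
      omega

/-- A path of the Markov chain is followed by the trajectory when the numbers lie in suitable
sets of positive measure. -/
lemma ReachIn.exists_sets (hadd : AddInvariant p) {n k : ℕ} {x y : Fin n → A}
    (h : ReachIn p n k x y) (hx : x ∈ admStrings p n) :
    ∃ (l : List A) (S : ℕ → Set ℝ), Compatible p (l.map WithTop.some) ∧
      (∀ i : Fin n, l[(i : ℕ)]? = some (y i)) ∧
      (∀ i, MeasurableSet (S i) ∧ S i ⊆ Set.Ico 0 1 ∧ volume (S i) ≠ 0) ∧
      ∀ v : ℕ → ℝ, (∀ i < k, v i ∈ S i) →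
        trajHist p (toStarList x) v k = l.map WithTop.some := by
  induction k generalizing y with
  | zero =>
    obtain rfl : x = y := h
    obtain ⟨a, ha, rfl⟩ := hx
    have hl : (List.ofFn (pastPrefix n a)).map WithTop.some = toStarList (pastPrefix n a) := by
      rw [List.map_ofFn]
      rfl
    refine ⟨List.ofFn (pastPrefix n a), fun _ => Set.Ico 0 1, ?_, ?_, ?_, ?_⟩
    · rw [hl]
      exact ⟨a, ha, (agrees_toStarList_iff _ _).2 rfl⟩
    · intro i
      simp
    · intro i
      refine ⟨measurableSet_Ico, subset_rfl, ?_⟩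
      simp
    · intro v _
      rw [hl]
      rfl
  | succ k ih =>
    obtain ⟨z, hz, hzm, hym, g, rfl, hg⟩ := reachIn_succ_iff.1 h
    obtain ⟨l, S, hc, hl, hS, hv⟩ := ih hz
    have hagree : ∀ a, Agrees (l.map WithTop.some) a → Agrees (toStarList z) a := by
      intro a ha
      rw [agrees_toStarList_iff]
      funext i
      refine ha i (z i) ?_
      rw [List.getElem?_map, hl i]
      rfl
    have hgz : 0 < alpha p g (toStarList z) := by
      rw [pMarkov] at hg
      by_contra! hle
      exact absurd hg (not_lt.2 (div_nonpos_of_nonpos_of_nonneg hle (beta_nonneg _)))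
    -- The trajectory uses its whole past, not only the last `n` symbols as the Markov chain does; a
    -- longer compatible past only increases the infimum.
    have hgl : 0 < alpha p g (l.map WithTop.some) := hgz.trans_le (alpha_mono g hc hagree)
    -- Without updates `refineValue` is `pick`, so this is the interval of numbers for which `pick`
    -- yields `g`.
    obtain ⟨hv1, hv2, hv3⟩ := volume_refineValue (p := p) (w₀ := l.map WithTop.some) (ws := [])
      trivial g
    classical
    refine ⟨g :: l, Function.update S k
      {u | 0 ≤ u ∧ refineValue p (l.map WithTop.some) [] u = g}, ?_, ?_, ?_, ?_⟩
    · obtain ⟨a, ha, haw⟩ := hc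
      refine ⟨consPast g a, hadd a ha g (hgl.trans_le (alpha_le_prob g ha haw)), ?_⟩
      exact agrees_cons (fun c hc => WithTop.coe_injective hc) haw
    · rintro ⟨_ | i, hi⟩
      · rfl
      · exact hl ⟨i, by omega⟩
    · intro i
      by_cases hi : i = k
      · subst hi
        rw [Function.update_self]
        refine ⟨hv1, hv2, ?_⟩
        rw [hv3]
        simpa using hgl
      · rw [Function.update_of_ne hi]
        exact hS i
    · intro v hvS
      have h1 : trajHist p (toStarList x) v k = l.map WithTop.some := by
        refine hv v fun i hi => ?_
        have := hvS i (by omega)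
        rwa [Function.update_of_ne hi.ne] at this
      have h2 := hvS k (by omega)
      rw [Function.update_self] at h2
      rw [trajHist, h1]
      exact congrArg (· :: _) h2.2

variable {Ω : Type*} [MeasurableSpace Ω] {μ : Measure Ω}
  {U : ℤ → stringsC p → Ω → ℝ}

/-- Choose for each starting string a path of length `k` to `b`. The trajectories use different
numbers, so following all the paths amounts to finitely many independent conditions of positive
probability. -/
lemma measure_coupling_ne_zero (hadd : AddInvariant p) (hmeas : ∀ m a, Measurable (U m a))
    (hunif : ∀ m a, μ.map (U m a) = volume.restrict (Set.Ico (0 : ℝ) 1))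
    (hindep : iIndepFun (fun q : ℤ × stringsC p => U q.1 q.2) μ) {k : ℕ} (hk : nhat p ≤ k)
    {b : Fin (nhat p) → A} (hb : ∀ a ∈ stringsC p, ReachIn p (nhat p) k a b) :
    0 < μ {ω | ∀ a : stringsC p, ∀ i : Fin (nhat p),
      traj p (toStarList a.1) (fun n => U n a ω) (k - 1 - i) = (b i : WithTop A)} := by
  classical
  have := Fintype.ofFinite (stringsC p)
  choose l S _ hl hS hv using fun a : stringsC p => (hb a.1 a.2).exists_sets hadd a.2
  let F : Finset (ℤ × stringsC p) := ((Finset.range k).image fun n : ℕ => (n : ℤ)) ×ˢ Finset.univ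
  have hprod := hindep.measure_inter_preimage_eq_mul F
    (sets := fun q => S q.2 q.1.toNat) fun q _ => (hS q.2 q.1.toNat).1
  have hpos : 0 < μ (⋂ q ∈ F, U q.1 q.2 ⁻¹' S q.2 q.1.toNat) := by
    rw [hprod, pos_iff_ne_zero, Finset.prod_ne_zero_iff]
    intro q _
    obtain ⟨h1, h2, h3⟩ := hS q.2 q.1.toNat
    rwa [← Measure.map_apply (hmeas q.1 q.2) h1, hunif, Measure.restrict_apply h1,
      Set.inter_eq_left.2 h2]
  refine hpos.trans_le (measure_mono fun ω hω a i => ?_)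
  have hi := i.2
  have htr := hv a (fun n => U n a ω) fun n hn => by
    simp only [Set.mem_iInter] at hω
    exact hω ((n : ℤ), a) (by simp [F, hn])
  have := trajHist_getElem? (p := p) (toStarList a.1) (fun n => U n a ω)
    (show (i : ℕ) < k by omega)
  rw [htr, List.getElem?_map, hl a i] at this
  simpa using this.symm

/-- The infimum defining the window length is attained only if some length is admissible. Any length
beyond the uniform mixing time of the chain and at least `n̂` is. -/
lemma windowLength_spec (hadd : AddInvariant p) (hp : StandingAssumption p)
    (hmeas : ∀ m a, Measurable (U m a))
    (hunif : ∀ m a, μ.map (U m a) = volume.restrict (Set.Ico (0 : ℝ) 1))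
    (hindep : iIndepFun (fun q : ℤ × stringsC p => U q.1 q.2) μ) :
    nhat p ≤ windowLength p μ U ∧ ∀ b ∈ closedClass p,
    0 < μ {ω | ∀ a : stringsC p, ∀ i : Fin (nhat p),
      traj p (toStarList a.1) (fun n => U n a ω) (windowLength p μ U - 1 - i) =
        (b i : WithTop A)} := by
  obtain ⟨T, hT⟩ := exists_forall_reachIn hp
  exact Nat.sInf_mem (s := {m | nhat p ≤ m ∧ ∀ b ∈ closedClass p,
    0 < μ {ω | ∀ a : stringsC p, ∀ i : Fin (nhat p),
      traj p (toStarList a.1) (fun n => U n a ω) (m - 1 - i) = (b i : WithTop A)}})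
    ⟨T + nhat p, by omega, fun b hb => measure_coupling_ne_zero hadd hmeas hunif hindep
      (by omega) fun a ha => hT _ (by omega) a ha b hb⟩

lemma coupled_iff {N : ℕ} (hN : 0 < N) (hn : nhat p ≤ N) (u : ℤ → stringsC p → ℝ) (j : ℤ)
    (b : Fin (nhat p) → A) : Coupled p N u j b ↔
      ∀ a : stringsC p, ∀ i : Fin (nhat p),
        traj p (toStarList a.1) (fun n => u (n + winStart N j) a) (N - 1 - i) = b i := by
  refine forall_congr' fun a => forall_congr' fun i => ?_
  have hi := i.2
  have hw : winIndex N (N * j - (i : ℕ)) = j :=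
    winIndex_eq_of hN (by rw [winStart_eq]; omega) (by omega)
  have hpos : winPos N (N * j - (i : ℕ)) = N - 1 - i := by
    have := winPos_cast hN (N * j - (i : ℕ))
    rw [hw, winStart_eq] at this
    omega
  have hu : (((N - 1 - i : ℕ)) : ℤ) + winStart N j = N * j - (i : ℕ) := by
    rw [winStart_eq]
    omega
  rw [localValue, localHist, hpos, hw, traj, hu]
  simp only [add_comm (winStart N j)]

/-- There are finitely many target strings, and by stationarity the coupling probability does not
depend on the window. -/
lemma exists_le_measure_coupled (hadd : AddInvariant p) (hp : StandingAssumption p)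
    (hmeas : ∀ m a, Measurable (U m a))
    (hunif : ∀ m a, μ.map (U m a) = volume.restrict (Set.Ico (0 : ℝ) 1))
    (hindep : iIndepFun (fun q : ℤ × stringsC p => U q.1 q.2) μ) :
    ∃ δ : ENNReal, δ ≠ 0 ∧ ∀ (j : ℤ), ∀ b ∈ closedClass p,
      δ ≤ μ {ω | Coupled p (windowLength p μ U) (fun m a => U m a ω) j b} := by
  classical
  obtain ⟨hn, hpos⟩ := windowLength_spec hadd hp hmeas hunif hindep
  have h1 := (exists_closedClass hp).1
  refine ⟨(Finset.univ.filter fun b => b ∈ closedClass p).inf fun b =>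
    μ {ω | ∀ a : stringsC p, ∀ i : Fin (nhat p),
      traj p (toStarList a.1) (fun n => U n a ω) (windowLength p μ U - 1 - i) =
        (b i : WithTop A)}, ?_, fun j b hb => ?_⟩
  · rw [← pos_iff_ne_zero, Finset.lt_inf_iff ENNReal.zero_lt_top]
    exact fun b hb => hpos b (by simpa using hb)
  · refine (Finset.inf_le (by simpa using hb)).trans (le_of_eq ?_)
    simp only [coupled_iff (h1.trans hn) hn]
    symm
    refine measure_shift hmeas hunif hindep (winStart (windowLength p μ U) j)
      (P := fun u => ∀ a : stringsC p, ∀ i : Fin (nhat p),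
        traj p (toStarList a.1) (fun n => u n a) (windowLength p μ U - 1 - i) = b i) ?_
    refine (DiscreteMeasurable.forall fun a => DiscreteMeasurable.forall fun i => ?_).setOf
    refine DiscreteMeasurable.map ?_ (· = (b i : WithTop A))
    exact discreteMeasurable_pick
      (discreteMeasurable_trajHist _
        (v := fun (n : ℕ) (x : ℤ × stringsC p → ℝ) => x ((n : ℤ), a)) fun i _ => by fun_prop)
      (by fun_prop)

end Coupling

/-! ### A renewal argument -/

section Renewal

open Filter

variable {Ω : Type*} [MeasurableSpace Ω] {μ : Measure Ω} [IsProbabilityMeasure μ]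

/-- If successes satisfy a renewal inequality and have divergent total probability, then almost
surely one of them occurs. -/
lemma measureReal_iUnion_eq_one_of_renewal {K : ℕ → Set Ω} {q : ℕ → ℝ} {k₀ : ℕ}
    (hK : ∀ k, MeasurableSet (K k)) (hq : ∀ k, 0 ≤ q k) (hKq : ∀ k, q (k₀ + k) ≤ μ.real (K k))
    (hren : ∀ i k, i < k →
      μ.real (K k ∩ disjointed K i) ≤ q (k - 1 - i) * μ.real (disjointed K i))
    (hdiv : Tendsto (fun n => ∑ k ∈ Finset.range n, q k) atTop atTop) :
    μ.real (⋃ k, K k) = 1 := by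
  -- `C i` is the event that `i` is the first index at which `K` occurs.
  set C := disjointed K with hC
  have hCm : ∀ i, MeasurableSet (C i) := fun i => MeasurableSet.disjointed hK i
  set c := μ.real (⋃ k, K k) with hc
  have hc0 : 0 ≤ c := measureReal_nonneg
  have hCsum : ∀ n, ∑ i ∈ Finset.range n, μ.real (C i) ≤ c := by
    intro n
    rw [← measureReal_biUnion_finset (fun i _ j _ hij => disjoint_disjointed K hij)
      fun i _ => hCm i]
    apply measureReal_mono _ (measure_ne_top _ _)
    exact Set.iUnion₂_subset fun i _ => (disjointed_subset K i).trans (Set.subset_iUnion K i)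
  have hdecomp : ∀ k, μ.real (K k) ≤
      μ.real (C k) + ∑ i ∈ Finset.range k, q (k - 1 - i) * μ.real (C i) := by
    intro k
    have hsub : K k ⊆ C k ∪ ⋃ i ∈ Finset.range k, K k ∩ C i := by
      intro ω hω
      by_cases h : ∃ i < k, ω ∈ C i
      · obtain ⟨i, hi, hωi⟩ := h
        exact Or.inr (Set.mem_iUnion₂.2 ⟨i, Finset.mem_range.2 hi, hω, hωi⟩)
      · left
        have : ω ∈ ⋃ i ≤ k, C i := by
          rw [hC, Set.mem_iUnion₂]
          have h2 : ω ∈ partialSups K k := le_partialSups K k hω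
          rw [← partialSups_disjointed, partialSups_eq_biUnion_range] at h2
          simp only [Set.mem_iUnion, Finset.mem_range, exists_prop] at h2
          obtain ⟨i, hi, hωi⟩ := h2
          exact ⟨i, by omega, hωi⟩
        obtain ⟨i, hi, hωi⟩ := Set.mem_iUnion₂.1 this
        rcases hi.lt_or_eq with hlt | rfl
        · exact absurd ⟨i, hlt, hωi⟩ h
        · exact hωi
    calc μ.real (K k) ≤ μ.real (C k ∪ ⋃ i ∈ Finset.range k, K k ∩ C i) :=
          measureReal_mono hsub (measure_ne_top _ _)
      _ ≤ μ.real (C k) + μ.real (⋃ i ∈ Finset.range k, K k ∩ C i) := measureReal_union_le _ _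
      _ ≤ μ.real (C k) + ∑ i ∈ Finset.range k, μ.real (K k ∩ C i) := by
          gcongr
          exact measureReal_biUnion_finset_le _ _
      _ ≤ _ := by
          gcongr with i hi
          exact hren i k (Finset.mem_range.1 hi)
  -- After exchanging the sums, each `μ.real (C i)` is multiplied by one plus a partial sum of `q`,
  -- and these measures add up to at most `c`.
  have hbound : ∀ n, ∑ k ∈ Finset.range n, q (k₀ + k) ≤
      c * (1 + ∑ k ∈ Finset.range n, q k) := by
    intro n
    have hinner : ∀ i, ∑ k ∈ Finset.Ico (i + 1) n, q (k - 1 - i) ≤ ∑ k ∈ Finset.range n, q k := by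
      intro i
      rw [Finset.sum_Ico_eq_sum_range]
      have : ∀ l, i + 1 + l - 1 - i = l := fun l => by omega
      simp only [this]
      exact Finset.sum_le_sum_of_subset_of_nonneg (by simp) fun k _ _ => hq k
    have hswap : ∑ k ∈ Finset.range n, ∑ i ∈ Finset.range k, q (k - 1 - i) * μ.real (C i) =
        ∑ i ∈ Finset.range n, ∑ k ∈ Finset.Ico (i + 1) n, q (k - 1 - i) * μ.real (C i) := by
      apply Finset.sum_comm'
      intro k i
      simp only [Finset.mem_range, Finset.mem_Ico]
      omega
    calc ∑ k ∈ Finset.range n, q (k₀ + k)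
        ≤ ∑ k ∈ Finset.range n,
          (μ.real (C k) + ∑ i ∈ Finset.range k, q (k - 1 - i) * μ.real (C i)) :=
          Finset.sum_le_sum fun k _ => (hKq k).trans (hdecomp k)
      _ = ∑ i ∈ Finset.range n,
          μ.real (C i) * (1 + ∑ k ∈ Finset.Ico (i + 1) n, q (k - 1 - i)) := by
          rw [Finset.sum_add_distrib, hswap, ← Finset.sum_add_distrib]
          refine Finset.sum_congr rfl fun i _ => ?_
          rw [← Finset.sum_mul]
          ring
      _ ≤ ∑ i ∈ Finset.range n, μ.real (C i) * (1 + ∑ k ∈ Finset.range n, q k) := by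
          gcongr with i _
          exact hinner i
      _ ≤ c * (1 + ∑ k ∈ Finset.range n, q k) := by
          rw [← Finset.sum_mul]
          have := Finset.sum_nonneg fun k (_ : k ∈ Finset.range n) => hq k
          gcongr
          exact hCsum n
  apply le_antisymm measureReal_le_one
  by_contra! hlt
  set S₀ := ∑ k ∈ Finset.range k₀, q k with hS₀
  have hS : ∀ n, ∑ k ∈ Finset.range (k₀ + n), q k = S₀ + ∑ k ∈ Finset.range n, q (k₀ + k) :=
    fun n => Finset.sum_range_add q k₀ n
  have hle : ∀ n, ∑ k ∈ Finset.range (k₀ + n), q k ≤ S₀ + c * (1 + S₀) / (1 - c) := by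
    intro n
    rw [hS]
    have h1 : ∑ k ∈ Finset.range n, q k ≤ S₀ + ∑ k ∈ Finset.range n, q (k₀ + k) := by
      rw [← hS]
      exact Finset.sum_le_sum_of_subset_of_nonneg (by simp) fun k _ _ => hq k
    have h2 := hbound n
    -- Writing `x` for the left side, `h1` and `h2` give `x ≤ c (1 + S₀ + x)`, which is solved for
    -- `x` because `c < 1`.
    have h3 : ∑ k ∈ Finset.range n, q (k₀ + k) ≤ c * (1 + S₀) / (1 - c) := by
      rw [le_div_iff₀ (by linarith)]
      nlinarith [mul_le_mul_of_nonneg_left h1 hc0]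
    linarith
  obtain ⟨n, hn1, hn2⟩ := ((hdiv.eventually_gt_atTop (S₀ + c * (1 + S₀) / (1 - c))).and
    (eventually_ge_atTop k₀)).exists
  have := hle (n - k₀)
  rw [Nat.add_sub_cancel' hn2] at this
  linarith

end Renewal

/-! ### Divergence along multiples of the window length -/

section Divergence

open Filter

lemma tendsto_sum_mul_of_antitone {f : ℕ → ℝ} (hf : Antitone f) (h0 : ∀ n, 0 ≤ f n) {N : ℕ}
    (hN : 0 < N)
    (hdiv : Tendsto (fun M : ℕ => ∑ n ∈ Finset.Icc 1 M, f n) atTop atTop) :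
    Tendsto (fun M : ℕ => ∑ k ∈ Finset.range M, f (N * k)) atTop atTop := by
  -- Cut the series into blocks of length `N`; by monotonicity each block is at most `N` times its
  -- first term.
  have hle : ∀ K, ∑ n ∈ Finset.range (N * K), f n ≤ N * ∑ k ∈ Finset.range K, f (N * k) := by
    intro K
    induction K with
    | zero => simp
    | succ K ih =>
      rw [Nat.mul_succ, Finset.sum_range_add, Finset.sum_range_succ, mul_add]
      refine add_le_add ih ?_
      refine (Finset.sum_le_card_nsmul _ _ (f (N * K)) fun l _ => hf (by omega)).trans ?_
      simp
  -- One extra block is needed so that the indices up to `M` lie below `N (M + 1)`.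
  rw [← tendsto_add_atTop_iff_nat 1]
  have hN' : (0 : ℝ) < N := by exact_mod_cast hN
  refine tendsto_atTop_mono (fun M => ?_) (hdiv.const_mul_atTop (inv_pos.2 hN'))
  rw [inv_mul_le_iff₀ hN']
  refine le_trans ?_ (hle (M + 1))
  refine Finset.sum_le_sum_of_subset_of_nonneg (fun n hn => ?_) fun n _ _ => h0 n
  rw [Finset.mem_Icc] at hn
  rw [Finset.mem_range]
  nlinarith

variable {A : Type*} [Fintype A] {p : ProbKernel A}

lemma rhoTilde_nonneg (n : ℕ) : 0 ≤ rhoTilde p n :=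
  Finset.sum_nonneg fun _ _ => Finset.sum_nonneg fun _ _ => weight_nonneg _ _

/-- Summing over the most recent symbol gives a factor `β(·) ≤ 1`. -/
lemma rhoTilde_antitone : Antitone (rhoTilde p) := by
  apply antitone_nat_of_succ_le
  intro n
  refine Finset.sum_le_sum fun x _ => ?_
  rw [← (Fin.consEquiv fun _ : Fin (n + 1) => A).sum_comp, Fintype.sum_prod_type_right]
  refine Finset.sum_le_sum fun a _ => ?_
  have h : ∀ g : A, weight p (toStarList x) (List.ofFn (Fin.consEquiv (fun _ => A) (g, a))) =
      alpha p g ((List.ofFn a).map WithTop.some ++ toStarList x) *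
        weight p (toStarList x) (List.ofFn a) := by
    intro g
    rw [← weight_cons]
    congr 1
    exact List.ofFn_cons g a
  simp only [h]
  rw [← Finset.sum_mul]
  exact mul_le_of_le_one_left (weight_nonneg _ _) (beta_le_one _)

end Divergence

/-! ### Success almost surely -/

section AlmostSure

open Filter

variable {A : Type*} [Fintype A] [LinearOrder A] {p : ProbKernel A} {N : ℕ}
  {Ω : Type*} [MeasurableSpace Ω] {μ : Measure Ω} {U : ℤ → stringsC p → Ω → ℝ}

lemma measure_success_shift (hN : 0 < N) (hn : nhat p ≤ N) (hmeas : ∀ m a, Measurable (U m a))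
    (hunif : ∀ m a, μ.map (U m a) = volume.restrict (Set.Ico (0 : ℝ) 1))
    (hindep : iIndepFun (fun q : ℤ × stringsC p => U q.1 q.2) μ) {j z : ℤ} (hjz : j ≤ z)
    (s : ℤ) :
    μ {ω | Success p N (fun m a => U m a ω) (j + s) (z + s)} =
      μ {ω | Success p N (fun m a => U m a ω) j z} := by
  rw [← measure_shift hmeas hunif hindep (N * s) (P := fun u => Success p N u j z)]
  · simp only [← success_shift hN s j z]
  · exact (discreteMeasurable_success (U := fun m a (x : ℤ × stringsC p → ℝ) => x (m, a)) hN hn hjz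
      fun m a _ _ => by fun_prop).setOf

/-- Almost surely, every window is the end of a success that starts arbitrarily far in the
past. -/
lemma ae_exists_success [IsProbabilityMeasure μ] (hN : 0 < N) (hn : nhat p ≤ N)
    (hmeas : ∀ m a, Measurable (U m a))
    (hunif : ∀ m a, μ.map (U m a) = volume.restrict (Set.Ico (0 : ℝ) 1))
    (hindep : iIndepFun (fun q : ℤ × stringsC p => U q.1 q.2) μ)
    (hdiv : Tendsto (fun n : ℕ => ∑ k ∈ Finset.range n,
      μ.real {ω | Success p N (fun m a => U m a ω) (-(k : ℤ)) 0}) atTop atTop) (z : ℤ) (k₀ : ℕ) :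
    ∀ᵐ ω ∂μ, ∃ k : ℕ, k₀ ≤ k ∧ Success p N (fun m a => U m a ω) (z - k) z := by
  set q : ℕ → ℝ := fun k => μ.real {ω | Success p N (fun m a => U m a ω) (-(k : ℤ)) 0} with hq
  set K : ℕ → Set Ω := fun k => {ω | Success p N (fun m a => U m a ω) (z - (k₀ + k : ℕ)) z}
    with hK
  have hstat : ∀ (z : ℤ) (k : ℕ),
      μ.real {ω | Success p N (fun m a => U m a ω) (z - k) z} = q k := by
    intro z k
    have := measure_success_shift hN hn hmeas hunif hindep (j := -(k : ℤ)) (z := 0) (by omega) z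
    rw [zero_add, neg_add_eq_sub] at this
    simp only [hq, measureReal_def, this]
  have hKmeas : ∀ k, ∀ (S : Set ℤ), Set.Ici (winStart N (z - (k₀ + k : ℕ))) ⊆ S →
      MeasurableSet[timeSigma U S] (K k) := fun k S hS =>
    (discreteMeasurable_success hN hn (by omega) fun m a h1 _ =>
      measurable_timeSigma (hS (Set.mem_Ici.2 h1)) a).setOf
  have hKm : ∀ k, MeasurableSet (K k) := fun k =>
    timeSigma_le hmeas _ _ (hKmeas k _ subset_rfl)
  have hone := measureReal_iUnion_eq_one_of_renewal (μ := μ) (K := K) (q := q) (k₀ := k₀) hKm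
    (fun k => measureReal_nonneg) (fun k => (hstat z (k₀ + k)).ge) ?_ hdiv
  · have hae : (⋃ k, K k) ∈ ae μ := by
      rw [mem_ae_iff_prob_eq_one (MeasurableSet.iUnion hKm)]
      rw [measureReal_def] at hone
      exact (ENNReal.toReal_eq_one_iff _).1 hone
    filter_upwards [hae] with ω hω
    obtain ⟨k, hk⟩ := Set.mem_iUnion.1 hω
    exact ⟨k₀ + k, by omega, hk⟩
  · intro i k hik
    have hz : z - ((k₀ + k : ℕ) : ℤ) = z - ((k₀ + i : ℕ) : ℤ) - 1 - ((k - 1 - i : ℕ) : ℤ) := by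
      omega
    have hend : (N : ℤ) * (z - ((k₀ + i : ℕ) : ℤ) - 1) < winStart N (z - (k₀ + i : ℕ)) := by
      rw [winStart]
      omega
    -- `K k` restricts to the success `L` that ends just before the window where `K i` starts. `L`
    -- uses only numbers before that window and spans `k - 1 - i` windows after its coupling window,
    -- whence the index of `q`.
    set L : Set Ω := {ω | Success p N (fun m a => U m a ω) (z - (k₀ + k : ℕ))
      (z - (k₀ + i : ℕ) - 1)} with hL
    have hLq : μ.real L = q (k - 1 - i) := by
      rw [hL, hz]
      exact hstat _ _
    have hLm : MeasurableSet[timeSigma U (Set.Iio (winStart N (z - (k₀ + i : ℕ))))] L :=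
      (discreteMeasurable_success hN hn (by omega) fun m a _ h2 =>
        measurable_timeSigma (Set.mem_Iio.2 (by omega)) a).setOf
    have hCm : MeasurableSet[timeSigma U (Set.Ici (winStart N (z - (k₀ + i : ℕ))))]
        (disjointed K i) := by
      -- Only `K l` with `l ≤ i` enter here; they start no earlier than the window of `K i`, so this
      -- event uses only numbers from that window on.
      rw [disjointed_eq_inter_compl]
      refine (hKmeas i _ subset_rfl).inter
        (MeasurableSet.iInter fun l => MeasurableSet.iInter fun hl => ?_)
      refine (hKmeas l _ (Set.Ici_subset_Ici.2 (winStart_mono N ?_))).compl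
      omega
    have hsub : K k ⊆ L := fun ω hω => Success.mono hω (by omega)
    have hind := (Indep_iff _ _ _).1 (indep_timeSigma hmeas hindep
      (S := Set.Iio (winStart N (z - (k₀ + i : ℕ)))) (T := Set.Ici (winStart N (z - (k₀ + i : ℕ))))
      (by
        rw [Set.disjoint_left]
        exact fun x hx hx' => not_lt.2 (Set.mem_Ici.1 hx') (Set.mem_Iio.1 hx))) L _ hLm hCm
    rw [← hLq, measureReal_def, measureReal_def, measureReal_def, ← ENNReal.toReal_mul, ← hind]
    exact ENNReal.toReal_mono (measure_ne_top _ _)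
      (measure_mono (Set.inter_subset_inter_left _ hsub))

lemma abs_lt_top_of_mem_Icc {x : EReal} {a b : ℝ} (h1 : (a : EReal) ≤ x) (h2 : x ≤ b) :
    x.abs < ⊤ := by
  induction x with
  | bot => exact absurd h1 (by simp)
  | top => exact absurd h2 (by simp)
  | coe x =>
    rw [EReal.abs_def]
    exact ENNReal.ofReal_lt_top

variable {u : ℤ → stringsC p → ℝ}

/-- The success provides the lower bound `j` for every `T̃[k]` in the range. The upper bound holds
by definition, through the window index of `m`. -/
lemma Success.abs_TtildeRange_lt_top {j z m n : ℤ} (h : Success p N u j z) (hN : 0 < N)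
    (hmn : m ≤ n) (hn : n ≤ N * z) (hj : j < winIndex N m) :
    (TtildeRange p N u m n).abs < ⊤ := by
  obtain ⟨b, -, -, hs⟩ := h
  refine abs_lt_top_of_mem_Icc (a := j) (b := winIndex N m) ?_ ?_
  · refine le_iInf₂ fun k hk => le_sSup ⟨j, ?_, rfl⟩
    have h1 : winStart N (j + 1) ≤ m := (le_winIndex_iff hN).1 (by omega)
    have h2 : j ≤ winIndex N k := by
      have : j + 1 ≤ winIndex N k := (le_winIndex_iff hN).2 (h1.trans hk.1)
      omega
    have h3 := hs k (h1.trans hk.1) (hk.2.trans hn)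
    rw [stage, if_pos h2] at h3
    exact ⟨h2, h3⟩
  · refine (iInf₂_le m ⟨le_rfl, hmn⟩).trans (sSup_le ?_)
    rintro _ ⟨i, hi, rfl⟩
    simp only [EReal.coe_le_coe_iff, Int.cast_le]
    exact hi.1

lemma Success.algorithmStops {k r : ℕ} (h : Success p N u (-(r : ℤ)) 0) (hN : 0 < N)
    (hr : -(r : ℤ) < winIndex N (-(k : ℤ))) : AlgorithmStops p N u k := by
  obtain ⟨b, -, -, hs⟩ := h
  refine ⟨r, fun i hi => ?_⟩
  rw [run_eq_stage hN r 0 _ (by simp), zero_sub]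
  have h1 : winStart N (-(r : ℤ) + 1) ≤ -(k : ℤ) := (le_winIndex_iff hN).1 (by omega)
  exact hs _ (by omega) (by simp)

end AlmostSure

end PerfectSim

end

theorem theorem6 {A : Type*} [Fintype A] [LinearOrder A] (p : PerfectSim.ProbKernel A)
    (hadd : PerfectSim.AddInvariant p)
    (hp : PerfectSim.StandingAssumption p)
    (hrho : Filter.Tendsto (fun M : ℕ => ∑ n ∈ Finset.Icc 1 M, PerfectSim.rhoTilde p n)
      Filter.atTop Filter.atTop)
    {Ω : Type*} [MeasurableSpace Ω] (μ : Measure Ω) [IsProbabilityMeasure μ]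
    (U : ℤ → PerfectSim.stringsC p → Ω → ℝ)
    (hmeas : ∀ m a, Measurable (U m a))
    (hunif : ∀ m a, μ.map (U m a) = volume.restrict (Set.Ico (0 : ℝ) 1))
    (hindep : iIndepFun (fun q : ℤ × PerfectSim.stringsC p => U q.1 q.2) μ) :
    (∀ n : ℕ, 1 ≤ n → ∀ᵐ ω ∂μ,
      (PerfectSim.TtildeRange p (PerfectSim.windowLength p μ U) (fun m a => U m a ω) 0 n).abs
        < ⊤) ∧
    (∀ k : ℕ, ∀ᵐ ω ∂μ,
      PerfectSim.AlgorithmStops p (PerfectSim.windowLength p μ U) (fun m a => U m a ω) k) := by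
  open PerfectSim in
  obtain ⟨h1, hH, -, -, -⟩ := exists_closedClass hp
  have hn : nhat p ≤ windowLength p μ U := (windowLength_spec hadd hp hmeas hunif hindep).1
  obtain ⟨δ, hδ0, hδ⟩ := exists_le_measure_coupled hadd hp hmeas hunif hindep
  -- From here on only `n̂ ≤ N` and the uniform coupling bound `hδ` matter, not the minimality of
  -- the window length.
  generalize windowLength p μ U = N at hn hδ ⊢
  have hN : 0 < N := h1.trans hn
  -- Only `δ ≠ 0` is recorded; capping at `1` excludes `⊤`, whose `toReal` would be `0`.
  have hδ' : 0 < (min δ 1).toReal := ENNReal.toReal_pos (by simp [hδ0]) (by simp)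
  have hdiv : Filter.Tendsto (fun n : ℕ => ∑ k ∈ Finset.range n,
      μ.real {ω | Success p N (fun m a => U m a ω) (-(k : ℤ)) 0}) Filter.atTop Filter.atTop := by
    refine Filter.tendsto_atTop_mono (fun n => ?_)
      ((tendsto_sum_mul_of_antitone rhoTilde_antitone rhoTilde_nonneg hN hrho).atTop_mul_const hδ')
    rw [Finset.sum_mul]
    refine Finset.sum_le_sum fun k _ => ?_
    have hle := rhoTilde_mul_le_measure_success hadd hN h1 hn hH hmeas hunif hindep
      (j := -(k : ℤ)) (z := 0) (M := N * k) (by push_cast; ring)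
      fun b hb => (min_le_left δ 1).trans (hδ (-(k : ℤ)) b hb)
    have := ENNReal.toReal_mono (measure_ne_top _ _) hle
    rwa [ENNReal.toReal_mul, ENNReal.toReal_ofReal (rhoTilde_nonneg _)] at this
  have hae := ae_exists_success hN hn hmeas hunif hindep hdiv
  constructor
  · intro n _
    -- The offset forces the success to start strictly before the window of time `0`, so that all
    -- times from `0` to `n` lie after its coupling window.
    filter_upwards [hae (winIndex N n) (winIndex N n - winIndex N 0 + 1).toNat] with ω hω
    obtain ⟨k, hk, hs⟩ := hω
    exact hs.abs_TtildeRange_lt_top hN (by positivity) (le_winEnd hN _) (by omega)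
  · intro k
    -- Here the success must end with `I_0` and start strictly before the window of time `-k`.
    filter_upwards [hae 0 (-winIndex N (-(k : ℤ)) + 1).toNat] with ω hω
    obtain ⟨r, hr, hs⟩ := hω
    rw [zero_sub] at hs
    exact hs.algorithmStops hN (by omega)
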